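/- Let $g\ge 3$. Let $S_g$ be the closed orientable surface of genus $g$, realised as the double of a planar domain $D$: a closed annulus, whose inner boundary is called hole $1$, with $g-1$ disjoint open discs (holes $2,\dots,g$) removed along a radius, invariant under a reflection $r$ that preserves every hole. The two copies of $D$ are called the front and the back. Let $\iota$ be the hyperelliptic involution of $S_g$, which applies $r$ and exchanges front and back. Let $q_g:\mathcal L\to S_g$ be the regular infinite cyclic cover obtained by unrolling the annulus; $\mathcal L$ is the Jacob's ladder surface, and the group of deck transformations is generated by the handle shift $h_{g-1}$ (to the right by $g-1$ handles). Let $a_j$ ($1\le j\le g$) be the double of an arc in $D$ from hole $j$ to the outer boundary (all on the same side of the axis of $r$, and disjoint from each other), $c_j$ ($1\le j\le g-1$) the double of the arc on that axis from hole $j$ to hole $j+1$, $b_j$ ($2\le j\le g$) a curve on the front around hole $j$, and $\alpha_n$ ($1\le n\le g-2$) the curve on the front that separates the holes $1,\dots,n+1$ from the remaining holes and the outer boundary. Let $T_c$ denote the left Dehn twist about $c$, and let $$G=\{T_{a_1},\dots,T_{a_g},\;T_{b_2},\dots,T_{b_g},\;T_{c_1},\dots,T_{c_{g-1}},\;T_{\alpha_1}T_{\iota(\alpha_1)}^{-1},\dots,T_{\alpha_{g-2}}T_{\iota(\alpha_{g-2})}^{-1},\;\iota\},$$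 a set of isotopy classes of homeomorphisms of $S_g$ (the generators, due to Dey et al., of the group $\mathrm{LMod}_{q_g}(S_g)$ of mapping classes that lift to $\mathcal L$). A lift of a homeomorphism $f$ of $S_g$ is a homeomorphism $\widetilde f$ of $\mathcal L$ with $q_g\circ\widetilde f=f\circ q_g$. (1) Let $n\ge 0$, and for $1\le j\le n$ let $F_j$ be an element of $G$ or the inverse of one, let $f_j$ be a homeomorphism of $S_g$ that represents $F_j$, and let $\widetilde f_j$ be a lift of $f_j$. Put $f=f_1\cdots f_n$, $\widetilde f=\widetilde f_1\cdots\widetilde f_n$, and let $k$ be the number of $j$ with $F_j=\iota$. Then $\widetilde f$ is a lift of $f$, and - $h_{g-1}\circ\widetilde f=\widetilde f\circ h_{g-1}$ if and only if $k$ is even; - $h_{g-1}\circ\widetilde f=\widetilde f\circ h_{g-1}^{-1}$ if and only if $k$ is odd; - consequently, if $k$ is odd, then $\widetilde f^{\,2}$ commutes with $h_{g-1}$. (2) Let $f$ be any homeomorphism of $S_g$ with a lift $\widetilde f$ such that $h_{g-1}\circ\widetilde f\circ h_{g-1}=\widetilde f$. Then $\widetilde f^{\,2}$ is a lift of $f^2$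 and $h_{g-1}\circ\widetilde f^{\,2}\circ h_{g-1}^{-1}=\widetilde f^{\,2}$. -/

import Mathlib

noncomputable section

namespace LadderCover

open Set

/-! ## Lifts, isotopy, mapping classes -/

/-- `f'` is a lift of `f` under `q`. -/
def IsLift {X Y : Type*} [TopologicalSpace X] [TopologicalSpace Y] (q : Y → X)
    (f : X ≃ₜ X) (f' : Y ≃ₜ Y) : Prop :=
  ∀ y, q (f' y) = f (q y)

/-- Two homeomorphisms are isotopic: they are joined by a homotopy through homeomorphisms. -/
def Isotopic {X : Type*} [TopologicalSpace X] (f f' : X ≃ₜ X) : Prop :=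
  ContinuousMap.HomotopicWith (f : C(X, X)) (f' : C(X, X)) (fun k => IsHomeomorph k)

theorem Isotopic.refl {X : Type*} [TopologicalSpace X] (f : X ≃ₜ X) : Isotopic f f :=
  ContinuousMap.HomotopicWith.refl _ f.isHomeomorph

theorem Isotopic.symm {X : Type*} [TopologicalSpace X] {f f' : X ≃ₜ X} (H : Isotopic f f') :
    Isotopic f' f :=
  ContinuousMap.HomotopicWith.symm H

theorem Isotopic.trans {X : Type*} [TopologicalSpace X] {f f' f'' : X ≃ₜ X}
    (H : Isotopic f f') (H' : Isotopic f' f'') : Isotopic f f'' :=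
  ContinuousMap.HomotopicWith.trans H H'

theorem Isotopic.mul {X : Type*} [TopologicalSpace X] {f f' k k' : X ≃ₜ X}
    (H : Isotopic f f') (K : Isotopic k k') : Isotopic (f * k) (f' * k') := by
  obtain ⟨H⟩ := H
  obtain ⟨K⟩ := K
  refine ⟨⟨⟨⟨fun p => H (p.1, K p), by fun_prop⟩, ?_, ?_⟩, ?_⟩⟩
  · intro x
    change H (0, K (0, x)) = f (k x)
    rw [K.apply_zero, H.apply_zero]; rfl
  · intro x
    change H (1, K (1, x)) = f' (k' x)
    rw [K.apply_one, H.apply_one]; rfl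
  · intro t
    exact (H.prop' t).comp (K.prop' t)

/-- Isotopy, as a congruence on the group of self-homeomorphisms of `X`. -/
def isotopyCon (X : Type*) [TopologicalSpace X] : Con (X ≃ₜ X) where
  r := Isotopic
  iseqv := ⟨Isotopic.refl, Isotopic.symm, Isotopic.trans⟩
  mul' := Isotopic.mul

/-- The group of isotopy classes of all self-homeomorphisms of `X` (for an orientable surface, the
extended mapping class group; the mapping class group is the subgroup of the classes that
preserve orientation). -/
abbrev MCG (X : Type*) [TopologicalSpace X] : Type _ := (isotopyCon X).Quotient

/-- The class of a homeomorphism. -/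
def cls {X : Type*} [TopologicalSpace X] (f : X ≃ₜ X) : MCG X := (f : (isotopyCon X).Quotient)

/-! ## Dehn twists -/

/-- The standard left twist `(w, t) ↦ (e^{2πit} w, t)` of the annulus `S¹ × [0,1]`. -/
def stdTwist : Circle × unitInterval ≃ₜ Circle × unitInterval where
  toFun a := (Circle.exp (2 * Real.pi * a.2) * a.1, a.2)
  invFun a := ((Circle.exp (2 * Real.pi * a.2))⁻¹ * a.1, a.2)
  left_inv a := by simp
  right_inv a := by simp
  continuous_toFun := by fun_prop
  continuous_invFun := by fun_prop

/-- A closed annulus embedded in a space `X`, with open interior. -/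
structure Annulus (X : Type*) [TopologicalSpace X] where
  toMap : C(Circle × unitInterval, X)
  inj : Function.Injective toMap
  isOpen_interior : IsOpen (toMap '' {a | (a.2 : ℝ) ∈ Ioo (0 : ℝ) 1})

/-- The image of an annulus under a homeomorphism. -/
def Annulus.map {X : Type*} [TopologicalSpace X] (e : Annulus X) (k : X ≃ₜ X) : Annulus X where
  toMap := (k : C(X, X)).comp e.toMap
  inj := k.injective.comp e.inj
  isOpen_interior := by
    have := k.isOpenMap _ e.isOpen_interior
    rw [Set.image_image] at this
    exact this

open Classical in
/-- Extend a self-map of the annulus by the identity. -/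
def Annulus.extend {X : Type*} [TopologicalSpace X] (e : Annulus X)
    (φ : Circle × unitInterval → Circle × unitInterval) (x : X) : X :=
  if H : ∃ a, e.toMap a = x then e.toMap (φ H.choose) else x

theorem Annulus.extend_apply {X : Type*} [TopologicalSpace X] (e : Annulus X)
    (φ : Circle × unitInterval → Circle × unitInterval) (a : Circle × unitInterval) :
    e.extend φ (e.toMap a) = e.toMap (φ a) := by
  have H : ∃ b, e.toMap b = e.toMap a := ⟨a, rfl⟩
  rw [Annulus.extend, dif_pos H, e.inj H.choose_spec]

theorem Annulus.extend_of_notMem {X : Type*} [TopologicalSpace X] (e : Annulus X)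
    (φ : Circle × unitInterval → Circle × unitInterval) {x : X} (hx : ∀ a, e.toMap a ≠ x) :
    e.extend φ x = x := by
  rw [Annulus.extend, dif_neg (by simpa using hx)]

theorem Annulus.continuous_extend {X : Type*} [TopologicalSpace X] [T2Space X] (e : Annulus X)
    {φ : Circle × unitInterval → Circle × unitInterval} (hφ : Continuous φ)
    (hb : ∀ a, (a.2 : ℝ) ∉ Ioo (0 : ℝ) 1 → φ a = a) : Continuous (e.extend φ) := by
  have hE := e.toMap.continuous.isClosedEmbedding e.inj
  have h1 : ContinuousOn (e.extend φ) (range e.toMap) := by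
    rw [← image_univ, hE.isInducing.continuousOn_image_iff, continuousOn_univ]
    have : e.extend φ ∘ e.toMap = e.toMap ∘ φ := funext (e.extend_apply φ)
    rw [this]
    exact e.toMap.continuous.comp hφ
  have h2 : ContinuousOn (e.extend φ) (e.toMap '' {a | (a.2 : ℝ) ∈ Ioo (0 : ℝ) 1})ᶜ := by
    refine continuousOn_id.congr fun x hx => ?_
    by_cases H : ∃ a, e.toMap a = x
    · obtain ⟨a, rfl⟩ := H
      rw [e.extend_apply, hb a (fun h => hx ⟨a, h, rfl⟩)]; rfl
    · push Not at H
      exact e.extend_of_notMem φ H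
  have h3 := h1.union_of_isClosed h2 hE.isClosed_range e.isOpen_interior.isClosed_compl
  rw [← continuousOn_univ]
  refine h3.mono fun x _ => ?_
  by_cases H : x ∈ range e.toMap
  · exact Or.inl H
  · exact Or.inr fun ⟨a, _, ha⟩ => H ⟨a, ha⟩

theorem Annulus.extend_extend {X : Type*} [TopologicalSpace X] (e : Annulus X)
    {φ ψ : Circle × unitInterval → Circle × unitInterval} (h : ∀ a, φ (ψ a) = a) (x : X) :
    e.extend φ (e.extend ψ x) = x := by
  by_cases H : ∃ a, e.toMap a = x
  · obtain ⟨a, rfl⟩ := H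
    rw [e.extend_apply, e.extend_apply, h]
  · push Not at H
    rw [e.extend_of_notMem ψ H, e.extend_of_notMem φ H]

theorem exp_twist_boundary (t : unitInterval) (ht : (t : ℝ) ∉ Ioo (0 : ℝ) 1) :
    Circle.exp (2 * Real.pi * t) = 1 := by
  have h0 := t.2.1
  have h1 := t.2.2
  rcases h0.eq_or_lt with h | h
  · rw [← h]; simp
  · have : (t : ℝ) = 1 := le_antisymm h1 (not_lt.1 fun h' => ht ⟨h, h'⟩)
    rw [this]; simp

/-- The left Dehn twist along an embedded annulus: `stdTwist` in the annulus, the identity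
outside. -/
def dehnTwist {X : Type*} [TopologicalSpace X] [T2Space X] (e : Annulus X) : X ≃ₜ X where
  toFun := e.extend stdTwist
  invFun := e.extend stdTwist.symm
  left_inv := e.extend_extend stdTwist.left_inv
  right_inv := e.extend_extend stdTwist.right_inv
  continuous_toFun := e.continuous_extend stdTwist.continuous fun a ha => by
    ext1
    · change Circle.exp (2 * Real.pi * a.2) * a.1 = a.1
      rw [exp_twist_boundary _ ha, one_mul]
    · rfl
  continuous_invFun := e.continuous_extend stdTwist.symm.continuous fun a ha => by
    ext1
    · change (Circle.exp (2 * Real.pi * a.2))⁻¹ * a.1 = a.1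
      rw [exp_twist_boundary _ ha, inv_one, one_mul]
    · rfl

/-! ## The closed surface of genus `g`, the ladder, and the covering map

The planar domain is the annulus `{(u, y) : u ∈ S¹, 0 ≤ y ≤ g}` with `g - 1` open discs removed,
centred at `(1, j)` for `j = 1, …, g - 1`.  The closed surface `Surf g` is its double: two copies,
the front `z ≥ 0` and the back `z ≤ 0`, glued along the boundary, realised as `z² = edge g u y`,
where `edge` is positive in the interior of the domain and zero on its boundary.  The `g` holes of
`Surf g` are the boundary circle `y = 0` (hole `0`) and the `g - 1` removed discs (hole `j` for
`1 ≤ j < g`); the outer boundary is `y = g`. -/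

/-- The removed disc number `j` is where this function is negative; with `u = e^{iθ}` the disc is
`2 sin²(θ/2) + 4 (y - j)² < 1 / (j+2)²`. -/
def hole (j : ℕ) (u : Circle) (y : ℝ) : ℝ :=
  (1 - (u : ℂ).re) + (2 * (y - j)) ^ 2 - (1 / ((j : ℝ) + 2)) ^ 2

/-- The annulus with `g - 1` holes. -/
def Plan (g : ℕ) : Set (Circle × ℝ) :=
  {p | 0 ≤ p.2 ∧ p.2 ≤ g ∧ ∀ j ∈ Finset.Ico 1 g, 0 ≤ hole j p.1 p.2}

/-- Nonnegative on `Plan g`, and zero exactly on its boundary. -/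
def edge (g : ℕ) (u : Circle) (y : ℝ) : ℝ :=
  y * (g - y) * ∏ j ∈ Finset.Ico 1 g, hole j u y

/-- The closed orientable surface of genus `g` (`g ≥ 1`), in `S¹ × ℝ × ℝ`. -/
def Surf (g : ℕ) : Set (Circle × ℝ × ℝ) :=
  {p | (p.1, p.2.1) ∈ Plan g ∧ p.2.2 ^ 2 = edge g p.1 p.2.1}

/-- The ladder surface in `ℝ³` (for `g ≥ 2`): the part over `k - 1/2 ≤ x ≤ k + 1/2` is a rung
with `g - 1` handles, for each integer `k`. -/
def Ladder (g : ℕ) : Set (ℝ × ℝ × ℝ) :=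
  {p | (Circle.exp (2 * Real.pi * p.1), p.2.1, p.2.2) ∈ Surf g}

/-- The covering map from the ladder to the closed surface, `(x, y, z) ↦ (e^{2πix}, y, z)`. -/
def cover (g : ℕ) (p : Ladder g) : Surf g :=
  ⟨(Circle.exp (2 * Real.pi * p.1.1), p.1.2.1, p.1.2.2), p.2⟩

theorem exp_shift (x : ℝ) : Circle.exp (2 * Real.pi * (x + 1)) = Circle.exp (2 * Real.pi * x) := by
  rw [mul_add, mul_one, Circle.exp_add_two_pi]

/-- The handle shift to the right by `g - 1` handles, `(x, y, z) ↦ (x + 1, y, z)`; it generates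
the group of deck transformations of `cover g`. -/
def handleShift (g : ℕ) : Ladder g ≃ₜ Ladder g where
  toFun p := ⟨(p.1.1 + 1, p.1.2), by
    have := p.2
    simp only [Ladder, mem_ofPred_eq] at this ⊢
    rwa [exp_shift]⟩
  invFun p := ⟨(p.1.1 - 1, p.1.2), by
    have := p.2
    simp only [Ladder, mem_ofPred_eq] at this ⊢
    rwa [← exp_shift, sub_add_cancel]⟩
  left_inv p := by ext <;> simp
  right_inv p := by ext <;> simp
  continuous_toFun := by fun_prop
  continuous_invFun := by fun_prop

/-- The hyperelliptic involution `(u, y, z) ↦ (ū, y, -z)`: the rotation by `π` about an axis that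
meets the surface in `2g + 2` points. It is covered by the rotation `(x, y, z) ↦ (-x, y, -z)`. -/
def hyperelliptic (g : ℕ) : Surf g ≃ₜ Surf g where
  toFun p := ⟨(p.1.1⁻¹, p.1.2.1, -p.1.2.2), by
    have := p.2
    simpa [Surf, Plan, edge, hole] using this⟩
  invFun p := ⟨(p.1.1⁻¹, p.1.2.1, -p.1.2.2), by
    have := p.2
    simpa [Surf, Plan, edge, hole] using this⟩
  left_inv p := by ext <;> simp
  right_inv p := by ext <;> simp
  continuous_toFun := by fun_prop
  continuous_invFun := by fun_prop

theorem edge_nonneg {g : ℕ} {u : Circle} {y : ℝ} (h : (u, y) ∈ Plan g) : 0 ≤ edge g u y :=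
  mul_nonneg (mul_nonneg h.1 (sub_nonneg.2 h.2.1)) (Finset.prod_nonneg h.2.2)

theorem edge_eq_zero_iff {g : ℕ} {u : Circle} {y : ℝ} :
    edge g u y = 0 ↔ y = 0 ∨ y = g ∨ ∃ j ∈ Finset.Ico 1 g, hole j u y = 0 := by
  rw [edge, mul_eq_zero, mul_eq_zero, sub_eq_zero, Finset.prod_eq_zero_iff, or_assoc,
    eq_comm (a := (g : ℝ))]

theorem continuous_edge (g : ℕ) : Continuous fun p : Circle × ℝ => edge g p.1 p.2 := by
  unfold edge hole
  fun_prop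

theorem rad_pos (j : ℕ) : 0 < 1 / ((j : ℝ) + 2) := by positivity

theorem rad_le_half (j : ℕ) : 1 / ((j : ℝ) + 2) ≤ 1 / 2 := by
  apply one_div_le_one_div_of_le <;> linarith [(Nat.cast_nonneg j : (0 : ℝ) ≤ j)]

theorem rad_anti {i j : ℕ} (h : i ≤ j) : 1 / ((j : ℝ) + 2) ≤ 1 / ((i : ℝ) + 2) := by
  have : (i : ℝ) ≤ j := by exact_mod_cast h
  apply one_div_le_one_div_of_le <;> linarith [(Nat.cast_nonneg i : (0 : ℝ) ≤ i)]

theorem rad_strictAnti (i : ℕ) : 1 / ((i : ℝ) + 3) < 1 / ((i : ℝ) + 2) := by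
  apply one_div_lt_one_div_of_lt <;> linarith [(Nat.cast_nonneg i : (0 : ℝ) ≤ i)]

theorem circle_re_le (u : Circle) : (u : ℂ).re ≤ 1 :=
  (Complex.re_le_norm _).trans (Circle.norm_coe u).le

theorem hole_pos_of_far {j : ℕ} {u : Circle} {y : ℝ} (h : 1 / 4 < (y - j) ^ 2) :
    0 < hole j u y := by
  have h1 := circle_re_le u
  have h2 := rad_le_half j
  have h3 := rad_pos j
  unfold hole
  nlinarith

/-! ### A coordinate around `u = 1` on the circle -/

/-- The point `u = e^{iθ}`, `|θ| ≤ π`, with `√2 sin (θ/2) = X` (for `|X| ≤ √2`). -/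
def xi (X : ℝ) : Circle := Circle.exp (2 * Real.arcsin (X / √2))

/-- The inverse of `xi`. -/
def chi (u : Circle) : ℝ := √2 * Real.sin ((u : ℂ).arg / 2)

theorem continuous_xi : Continuous xi := by
  unfold xi
  exact Circle.exp.continuous.comp (by fun_prop)

theorem sq_le_two {X : ℝ} (h : X ∈ Ioo (-1 : ℝ) 1) : -1 < X / √2 ∧ X / √2 < 1 := by
  have h2 : 1 < √2 := by
    rw [Real.lt_sqrt] <;> norm_num
  constructor
  · rw [lt_div_iff₀ (by linarith)]; linarith [h.1]
  · rw [div_lt_iff₀ (by linarith)]; linarith [h.2]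

theorem xi_re {X : ℝ} (h : X ∈ Ioo (-1 : ℝ) 1) : (xi X : ℂ).re = 1 - X ^ 2 := by
  have h2 := sq_le_two h
  rw [xi, Circle.coe_exp, Complex.exp_ofReal_mul_I_re, Real.cos_two_mul, Real.cos_sq',
    Real.sin_arcsin h2.1.le h2.2.le, div_pow, Real.sq_sqrt (by norm_num)]
  ring

theorem chi_xi {X : ℝ} (h : X ∈ Ioo (-1 : ℝ) 1) : chi (xi X) = X := by
  have h2 := sq_le_two h
  have h3 := Real.arcsin_lt_pi_div_two.2 h2.2
  have h4 := Real.neg_pi_div_two_lt_arcsin.2 h2.1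
  rw [chi, xi, Circle.arg_exp (by linarith) (by linarith), mul_div_cancel_left₀ _ (by norm_num),
    Real.sin_arcsin h2.1.le h2.2.le, mul_div_cancel₀]
  positivity

theorem xi_chi (u : Circle) : xi (chi u) = u := by
  have h1 := Complex.neg_pi_lt_arg (u : ℂ)
  have h2 := Complex.arg_le_pi (u : ℂ)
  rw [chi, xi, mul_div_cancel_left₀ _ (by positivity), Real.arcsin_sin (by linarith) (by linarith),
    mul_div_cancel₀ _ (by norm_num), Circle.exp_arg]

theorem chi_sq (u : Circle) : chi u ^ 2 = 1 - (u : ℂ).re := by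
  have h : (u : ℂ).re = Real.cos (u : ℂ).arg := by
    conv_lhs => rw [← Circle.exp_arg u, Circle.coe_exp, Complex.exp_ofReal_mul_I_re]
  rw [chi, mul_pow, Real.sq_sqrt (by norm_num), Real.sin_sq_eq_half_sub, h,
    mul_div_cancel₀ _ (by norm_num)]
  ring

theorem continuousOn_chi : ContinuousOn chi {u | 0 < (u : ℂ).re} := by
  intro u hu
  apply ContinuousAt.continuousWithinAt
  have h : ContinuousAt (fun u : Circle => (u : ℂ).arg) u :=
    (Complex.continuousAt_arg (Or.inl hu)).comp (by fun_prop : Continuous fun u : Circle => (u : ℂ)).continuousAt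
  unfold chi
  fun_prop

theorem hole_xi (j : ℕ) {X : ℝ} (h : X ∈ Ioo (-1 : ℝ) 1) (y : ℝ) :
    hole j (xi X) y = X ^ 2 + (2 * (y - j)) ^ 2 - (1 / ((j : ℝ) + 2)) ^ 2 := by
  rw [hole, xi_re h]; ring

/-- The set of `(u, y, z)` with `0 < Re u` and `chi u`, `y`, `z` in an open condition is open. -/
theorem isOpen_chart {g : ℕ} {W : Set (ℝ × ℝ × ℝ)} (hW : IsOpen W) :
    IsOpen {p : Surf g | 0 < (p.1.1 : ℂ).re ∧ (chi p.1.1, p.1.2.1, p.1.2.2) ∈ W} := by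
  have ho : IsOpen {p : Surf g | 0 < (p.1.1 : ℂ).re} :=
    isOpen_lt continuous_const (by fun_prop)
  have hc : ContinuousOn (fun p : Surf g => (chi p.1.1, p.1.2.1, p.1.2.2))
      {p : Surf g | 0 < (p.1.1 : ℂ).re} := by
    refine ContinuousOn.prodMk ?_ (by fun_prop)
    exact continuousOn_chi.comp (by fun_prop) fun p hp => hp
  exact hc.isOpen_inter_preimage ho hW

theorem abs_re_le (u : Circle) : -1 ≤ (u : ℂ).re ∧ (u : ℂ).re ≤ 1 := by
  have h := Complex.abs_re_le_norm (u : ℂ)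
  rw [Circle.norm_coe] at h
  exact abs_le.1 h

theorem sq_add_sq (u : Circle) : (u : ℂ).re ^ 2 + (u : ℂ).im ^ 2 = 1 := by
  have h := Circle.normSq_coe u
  rw [Complex.normSq_apply] at h
  nlinarith

theorem circle_ext {u v : Circle} (h1 : (u : ℂ).re = (v : ℂ).re)
    (h2 : 0 < (u : ℂ).im ↔ 0 < (v : ℂ).im) : u = v := by
  have hu := sq_add_sq u
  have hv := sq_add_sq v
  have h3 : ((u : ℂ).im - (v : ℂ).im) * ((u : ℂ).im + (v : ℂ).im) = 0 := by
    rw [h1] at hu; linarith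
  have h4 : (u : ℂ).im = (v : ℂ).im := by
    rcases mul_eq_zero.1 h3 with h | h
    · linarith
    · by_cases h5 : 0 < (u : ℂ).im
      · linarith [h2.1 h5]
      · have h6 := mt h2.2 h5
        linarith
  exact Circle.ext (Complex.ext h1 h4)

theorem exists_circle {c d : ℝ} (h : c ^ 2 + d ^ 2 = 1) :
    ∃ w : Circle, (w : ℂ).re = c ∧ (w : ℂ).im = d := by
  refine ⟨⟨⟨c, d⟩, ?_⟩, rfl, rfl⟩
  rw [Submonoid.unitSphere, Submonoid.mem_mk]
  change (⟨c, d⟩ : ℂ) ∈ Metric.sphere (0 : ℂ) 1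
  rw [mem_sphere_zero_iff_norm, ← sq_eq_sq₀ (norm_nonneg _) zero_le_one,
    ← Complex.normSq_eq_norm_sq, Complex.normSq_apply]
  change c * c + d * d = 1 ^ 2
  linarith

/-! ### Annuli that are doubles of vertical strips -/

/-- A vertical strip `left ≤ X ≤ right`, `lo X ≤ y ≤ hi X` in the planar domain, in the coordinate
`X` around `u = 1`, that meets the boundary of the domain exactly in its lower and upper ends; it is
cut out of the domain by the condition `bot < y < top`. -/
structure Strip (g : ℕ) where
  left : ℝ
  right : ℝ
  lo : ℝ → ℝ
  hi : ℝ → ℝ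
  bot : ℝ
  top : ℝ
  neg_one_lt : -1 < left
  left_lt : left < right
  right_lt : right < 1
  lo_cont : Continuous lo
  hi_cont : Continuous hi
  lo_lt_hi : ∀ X ∈ Icc left right, lo X < hi X
  bot_lt : ∀ X ∈ Icc left right, bot < lo X
  lt_top : ∀ X ∈ Icc left right, hi X < top
  mem_iff : ∀ X ∈ Icc left right, ∀ y ∈ Ioo bot top,
    (xi X, y) ∈ Plan g ↔ y ∈ Icc (lo X) (hi X)
  edge_iff : ∀ X ∈ Icc left right, ∀ y ∈ Icc (lo X) (hi X),
    edge g (xi X) y = 0 ↔ y = lo X ∨ y = hi X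

namespace Strip

variable {g : ℕ} (s : Strip g)

/-- The coordinate `X` at the parameter `t`. -/
def xc (t : unitInterval) : ℝ := s.left + (s.right - s.left) * t

/-- The height `y` at the parameters `w`, `t`: from `lo` at `w = 1` to `hi` at `w = -1`. -/
def yc (a : Circle × unitInterval) : ℝ :=
  (s.lo (s.xc a.2) + s.hi (s.xc a.2)) / 2
    - (s.hi (s.xc a.2) - s.lo (s.xc a.2)) / 2 * (a.1 : ℂ).re

/-- The height `z`: front for `Im w ≥ 0`, back for `Im w ≤ 0`. -/
def zc (a : Circle × unitInterval) : ℝ :=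
  if 0 ≤ (a.1 : ℂ).im then √(edge g (xi (s.xc a.2)) (s.yc a))
  else -√(edge g (xi (s.xc a.2)) (s.yc a))

theorem xc_mem (t : unitInterval) : s.xc t ∈ Icc s.left s.right := by
  have := s.left_lt
  have h0 := t.2.1
  have h1 := t.2.2
  constructor <;> unfold xc <;> nlinarith

theorem mem_one {X : ℝ} (h : X ∈ Icc s.left s.right) : X ∈ Ioo (-1 : ℝ) 1 :=
  ⟨s.neg_one_lt.trans_le h.1, h.2.trans_lt s.right_lt⟩

theorem yc_mem (a : Circle × unitInterval) : s.yc a ∈ Icc (s.lo (s.xc a.2)) (s.hi (s.xc a.2)) := by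
  have h := s.lo_lt_hi _ (s.xc_mem a.2)
  have h1 := abs_re_le a.1
  constructor <;> unfold yc <;> nlinarith

theorem Icc_mem {X y : ℝ} (hX : X ∈ Icc s.left s.right) (hy : y ∈ Icc (s.lo X) (s.hi X)) :
    y ∈ Ioo s.bot s.top :=
  ⟨(s.bot_lt X hX).trans_le hy.1, hy.2.trans_lt (s.lt_top X hX)⟩

theorem plan_mem (a : Circle × unitInterval) : (xi (s.xc a.2), s.yc a) ∈ Plan g :=
  (s.mem_iff _ (s.xc_mem _) _ (s.Icc_mem (s.xc_mem _) (s.yc_mem a))).2 (s.yc_mem a)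

theorem edge_zero {a : Circle × unitInterval} (h : (a.1 : ℂ).im = 0) :
    edge g (xi (s.xc a.2)) (s.yc a) = 0 := by
  rw [s.edge_iff _ (s.xc_mem _) _ (s.yc_mem a)]
  have h1 := sq_add_sq a.1
  rw [h] at h1
  have h2 : ((a.1 : ℂ).re - 1) * ((a.1 : ℂ).re + 1) = 0 := by nlinarith
  rcases mul_eq_zero.1 h2 with h3 | h3
  · left; rw [yc, sub_eq_zero.1 h3]; ring
  · right; rw [yc, eq_neg_of_add_eq_zero_left h3]; ring

theorem im_zero {a : Circle × unitInterval} (h : edge g (xi (s.xc a.2)) (s.yc a) = 0) :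
    (a.1 : ℂ).im = 0 := by
  rw [s.edge_iff _ (s.xc_mem _) _ (s.yc_mem a)] at h
  have h0 := s.lo_lt_hi _ (s.xc_mem a.2)
  have h1 := sq_add_sq a.1
  have h2 : (a.1 : ℂ).re = 1 ∨ (a.1 : ℂ).re = -1 := by
    unfold yc at h
    rcases h with h | h
    · left
      have : (s.hi (s.xc a.2) - s.lo (s.xc a.2)) * ((a.1 : ℂ).re - 1) = 0 := by linarith
      rcases mul_eq_zero.1 this with h3 | h3 <;> linarith
    · right
      have : (s.hi (s.xc a.2) - s.lo (s.xc a.2)) * ((a.1 : ℂ).re + 1) = 0 := by linarith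
      rcases mul_eq_zero.1 this with h3 | h3 <;> linarith
  have : (a.1 : ℂ).im ^ 2 = 0 := by rcases h2 with h2 | h2 <;> rw [h2] at h1 <;> linarith
  exact pow_eq_zero_iff (two_ne_zero) |>.1 this

theorem zc_sq (a : Circle × unitInterval) : s.zc a ^ 2 = edge g (xi (s.xc a.2)) (s.yc a) := by
  have := edge_nonneg (s.plan_mem a)
  unfold zc
  split_ifs
  · exact Real.sq_sqrt this
  · rw [neg_sq, Real.sq_sqrt this]

theorem continuous_xc : Continuous s.xc := by
  unfold xc; fun_prop

theorem continuous_yc : Continuous s.yc := by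
  have h1 := s.lo_cont
  have h2 := s.hi_cont
  have h3 := s.continuous_xc
  unfold yc; fun_prop

theorem continuous_zc : Continuous s.zc := by
  have h1 := s.continuous_xc
  have h2 := s.continuous_yc
  have h3 : Continuous fun a : Circle × unitInterval => edge g (xi (s.xc a.2)) (s.yc a) :=
    (continuous_edge g).comp ((continuous_xi.comp (h1.comp continuous_snd)).prodMk h2)
  unfold zc
  refine Continuous.if_le (by fun_prop) (by fun_prop) continuous_const (by fun_prop) fun a ha => ?_
  rw [s.edge_zero ha.symm]; simp

/-- The double of a strip: an annulus in the surface. The parameter `t` runs from left to right,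
and the parameter `w` upwards on the front, downwards on the back. -/
def toMap : C(Circle × unitInterval, Surf g) where
  toFun a := ⟨(xi (s.xc a.2), s.yc a, s.zc a), s.plan_mem a, s.zc_sq a⟩
  continuous_toFun := by
    have h1 := s.continuous_xc
    have h2 := s.continuous_yc
    have h3 := s.continuous_zc
    have h4 := continuous_xi
    fun_prop

theorem zc_pos_iff (a : Circle × unitInterval) : 0 < s.zc a ↔ 0 < (a.1 : ℂ).im := by
  have h0 := edge_nonneg (s.plan_mem a)
  constructor
  · intro h
    unfold zc at h
    split_ifs at h with h1
    · rcases h1.eq_or_lt with h2 | h2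
      · rw [s.edge_zero h2.symm] at h; simp at h
      · exact h2
    · have := Real.sqrt_nonneg (edge g (xi (s.xc a.2)) (s.yc a))
      linarith
  · intro h
    rw [zc, if_pos h.le, Real.sqrt_pos]
    exact h0.lt_of_ne fun h1 => h.ne' (s.im_zero h1.symm)

theorem injective_toMap : Function.Injective s.toMap := by
  intro a b h
  have hx : xi (s.xc a.2) = xi (s.xc b.2) := congrArg (fun p : Surf g => p.1.1) h
  have hy : s.yc a = s.yc b := congrArg (fun p : Surf g => p.1.2.1) h
  have hz : s.zc a = s.zc b := congrArg (fun p : Surf g => p.1.2.2) h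
  have hx' : s.xc a.2 = s.xc b.2 := by
    rw [← chi_xi (s.mem_one (s.xc_mem a.2)), hx, chi_xi (s.mem_one (s.xc_mem b.2))]
  have ht : a.2 = b.2 := by
    have h1 := s.left_lt
    unfold xc at hx'
    have : (s.right - s.left) * ((a.2 : ℝ) - b.2) = 0 := by linarith
    rcases mul_eq_zero.1 this with h2 | h2
    · linarith
    · exact Subtype.ext (sub_eq_zero.1 h2)
  have hr : (a.1 : ℂ).re = (b.1 : ℂ).re := by
    have h0 := s.lo_lt_hi _ (s.xc_mem b.2)
    unfold yc at hy
    rw [ht] at hy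
    have : (s.hi (s.xc b.2) - s.lo (s.xc b.2)) * ((a.1 : ℂ).re - (b.1 : ℂ).re) = 0 := by linarith
    rcases mul_eq_zero.1 this with h2 | h2 <;> linarith
  refine Prod.ext (circle_ext hr ?_) ht
  rw [← s.zc_pos_iff, ← s.zc_pos_iff, hz]

theorem image_interior : s.toMap '' {a | (a.2 : ℝ) ∈ Ioo (0 : ℝ) 1} =
    {p : Surf g | 0 < (p.1.1 : ℂ).re ∧ (chi p.1.1, p.1.2.1, p.1.2.2) ∈
      {q : ℝ × ℝ × ℝ | (s.left < q.1 ∧ q.1 < s.right) ∧ (s.bot < q.2.1 ∧ q.2.1 < s.top)}} := by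
  have hlr := s.left_lt
  apply Subset.antisymm
  · rintro _ ⟨a, ha, rfl⟩
    have ha : 0 < (a.2 : ℝ) ∧ (a.2 : ℝ) < 1 := ha
    have hm := s.mem_one (s.xc_mem a.2)
    have hy := s.Icc_mem (s.xc_mem a.2) (s.yc_mem a)
    change 0 < (xi (s.xc a.2) : ℂ).re ∧ (s.left < chi (xi (s.xc a.2)) ∧
      chi (xi (s.xc a.2)) < s.right) ∧ (s.bot < s.yc a ∧ s.yc a < s.top)
    rw [xi_re hm, chi_xi hm]
    refine ⟨by nlinarith [hm.1, hm.2], ⟨?_, ?_⟩, hy⟩ <;> unfold xc <;> nlinarith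
  · rintro ⟨⟨u, y, z⟩, hP, hz⟩ ⟨hu, ⟨hl, hr⟩, hy⟩
    simp only at hP hz hu hl hr hy
    have hX : chi u ∈ Icc s.left s.right := ⟨hl.le, hr.le⟩
    have hd : 0 < s.right - s.left := by linarith
    let t : unitInterval := ⟨(chi u - s.left) / (s.right - s.left),
      div_nonneg (by linarith) hd.le, (div_le_one hd).2 (by linarith)⟩
    have ht : s.xc t = chi u := by
      change s.left + (s.right - s.left) * ((chi u - s.left) / (s.right - s.left)) = _
      rw [mul_div_cancel₀ _ hd.ne']; ring
    have hlh := s.lo_lt_hi _ hX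
    have hyI : y ∈ Icc (s.lo (chi u)) (s.hi (chi u)) := by
      rw [← s.mem_iff _ hX y hy, xi_chi]; exact hP
    have hD : 0 < s.hi (chi u) - s.lo (chi u) := by linarith
    set c : ℝ := (s.lo (chi u) + s.hi (chi u) - 2 * y) / (s.hi (chi u) - s.lo (chi u)) with hc
    have hc1 : -1 ≤ c := by rw [hc, le_div_iff₀ hD]; linarith [hyI.2]
    have hc2 : c ≤ 1 := by rw [hc, div_le_iff₀ hD]; linarith [hyI.1]
    have hcs : 0 ≤ 1 - c ^ 2 := by nlinarith
    obtain ⟨w, hwr, hwi⟩ : ∃ w : Circle, (w : ℂ).re = c ∧ (0 ≤ z ↔ 0 ≤ (w : ℂ).im) := by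
      by_cases h : 0 ≤ z
      · obtain ⟨w, h1, h2⟩ := exists_circle (c := c) (d := √(1 - c ^ 2))
          (by rw [Real.sq_sqrt hcs]; ring)
        refine ⟨w, h1, ?_⟩
        rw [h2]
        simp [h, Real.sqrt_nonneg]
      · have hpos : 0 < 1 - c ^ 2 := by
          refine hcs.lt_of_ne fun h0 => h ?_
          have h1 : (c - 1) * (c + 1) = 0 := by linarith
          have h2 : edge g (xi (chi u)) y = 0 := by
            rw [s.edge_iff _ hX _ hyI]
            have hcD : c * (s.hi (chi u) - s.lo (chi u)) = s.lo (chi u) + s.hi (chi u) - 2 * y :=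
              div_mul_cancel₀ _ hD.ne'
            rcases mul_eq_zero.1 h1 with h3 | h3
            · left; rw [sub_eq_zero.1 h3] at hcD; linarith
            · right; rw [eq_neg_of_add_eq_zero_left h3] at hcD; linarith
          rw [xi_chi] at h2
          rw [h2] at hz
          rw [pow_eq_zero_iff (two_ne_zero) |>.1 hz]
        obtain ⟨w, h1, h2⟩ := exists_circle (c := c) (d := -√(1 - c ^ 2))
          (by rw [neg_sq, Real.sq_sqrt hcs]; ring)
        refine ⟨w, h1, ?_⟩
        have := Real.sqrt_pos.2 hpos
        rw [h2]
        constructor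
        · intro h'; exact absurd h' h
        · intro h'; linarith
    have hyc : s.yc (w, t) = y := by
      change (s.lo (s.xc t) + s.hi (s.xc t)) / 2 - (s.hi (s.xc t) - s.lo (s.xc t)) / 2 *
        (w : ℂ).re = y
      rw [ht, hwr]
      have hcD : c * (s.hi (chi u) - s.lo (chi u)) = s.lo (chi u) + s.hi (chi u) - 2 * y :=
        div_mul_cancel₀ _ hD.ne'
      linarith
    have hzc : s.zc (w, t) = z := by
      change (if 0 ≤ (w : ℂ).im then √(edge g (xi (s.xc t)) (s.yc (w, t)))
        else -√(edge g (xi (s.xc t)) (s.yc (w, t)))) = z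
      rw [hyc, ht, xi_chi, ← hz, Real.sqrt_sq_eq_abs]
      by_cases h : 0 ≤ z
      · rw [if_pos (hwi.1 h), abs_of_nonneg h]
      · rw [if_neg (fun h' => h (hwi.2 h')), abs_of_neg (not_le.1 h), neg_neg]
    refine ⟨(w, t), ⟨?_, ?_⟩, ?_⟩
    · exact div_pos (by linarith) hd
    · exact (div_lt_one hd).2 (by linarith)
    · apply Subtype.ext
      change (xi (s.xc t), s.yc (w, t), s.zc (w, t)) = (u, y, z)
      rw [ht, xi_chi, hyc, hzc]

/-- The double of a strip, as an annulus in the surface. -/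
def annulus : Annulus (Surf g) where
  toMap := s.toMap
  inj := s.injective_toMap
  isOpen_interior := by
    rw [s.image_interior]
    refine isOpen_chart (IsOpen.and (IsOpen.and ?_ ?_) (IsOpen.and ?_ ?_)) <;>
      exact isOpen_lt (by fun_prop) (by fun_prop)

end Strip

/-! ### The curves -/

/-- Over the coordinate `X`, the top end of hole `i` (hole `0` ends at `y = 0`). -/
def holeTop (i : ℕ) (X : ℝ) : ℝ :=
  if i = 0 then 0 else i + √((1 / ((i : ℝ) + 2)) ^ 2 - X ^ 2) / 2

/-- Over the coordinate `X`, the lower end of hole `k ≥ 1`. -/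
def holeBot (k : ℕ) (X : ℝ) : ℝ := k - √((1 / ((k : ℝ) + 2)) ^ 2 - X ^ 2) / 2

theorem continuous_holeTop (i : ℕ) : Continuous (holeTop i) := by
  unfold holeTop
  split_ifs <;> fun_prop

theorem continuous_holeBot (i : ℕ) : Continuous (holeBot i) := by
  unfold holeBot
  fun_prop

theorem half_le {i : ℕ} {X : ℝ} :
    0 ≤ √((1 / ((i : ℝ) + 2)) ^ 2 - X ^ 2) ∧ √((1 / ((i : ℝ) + 2)) ^ 2 - X ^ 2) ≤ 1 / 2 := by
  refine ⟨Real.sqrt_nonneg _, Real.sqrt_le_iff.2 ⟨by norm_num, ?_⟩⟩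
  have := rad_pos i
  have := rad_le_half i
  nlinarith

theorem holeTop_le (i : ℕ) (X : ℝ) : (i : ℝ) ≤ holeTop i X ∧ holeTop i X ≤ i + 1 / 4 := by
  have := half_le (i := i) (X := X)
  unfold holeTop
  split_ifs with h
  · rw [h]; norm_num
  · constructor <;> linarith

theorem holeBot_le (i : ℕ) (X : ℝ) : (i : ℝ) - 1 / 4 ≤ holeBot i X ∧ holeBot i X ≤ i := by
  have := half_le (i := i) (X := X)
  unfold holeBot
  constructor <;> linarith

theorem hole_top {i : ℕ} (hi : i ≠ 0) {X y : ℝ} (hX : X ∈ Ioo (-1 : ℝ) 1)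
    (hXi : X ^ 2 < (1 / ((i : ℝ) + 2)) ^ 2) (hy : (i : ℝ) ≤ y) :
    (0 ≤ hole i (xi X) y ↔ holeTop i X ≤ y) ∧ (hole i (xi X) y = 0 ↔ y = holeTop i X) := by
  have h1 := Real.sq_sqrt (sub_nonneg.2 hXi.le)
  have h2 : 0 < √((1 / ((i : ℝ) + 2)) ^ 2 - X ^ 2) := Real.sqrt_pos.2 (sub_pos.2 hXi)
  rw [hole_xi i hX, holeTop, if_neg hi]
  set r := √((1 / ((i : ℝ) + 2)) ^ 2 - X ^ 2)
  have h3 : X ^ 2 + (2 * (y - i)) ^ 2 - (1 / ((i : ℝ) + 2)) ^ 2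
    = (2 * (y - i) - r) * (2 * (y - i) + r) := by linarith
  have h4 : 0 < 2 * (y - i) + r := by linarith
  rw [h3, mul_nonneg_iff_of_pos_right h4, mul_eq_zero, or_iff_left h4.ne']
  constructor <;> constructor <;> intro h <;> linarith

theorem hole_bot {i : ℕ} {X y : ℝ} (hX : X ∈ Ioo (-1 : ℝ) 1)
    (hXi : X ^ 2 < (1 / ((i : ℝ) + 2)) ^ 2) (hy : y ≤ i) :
    (0 ≤ hole i (xi X) y ↔ y ≤ holeBot i X) ∧ (hole i (xi X) y = 0 ↔ y = holeBot i X) := by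
  have h1 := Real.sq_sqrt (sub_nonneg.2 hXi.le)
  have h2 : 0 < √((1 / ((i : ℝ) + 2)) ^ 2 - X ^ 2) := Real.sqrt_pos.2 (sub_pos.2 hXi)
  rw [hole_xi i hX, holeBot]
  set r := √((1 / ((i : ℝ) + 2)) ^ 2 - X ^ 2)
  have h3 : X ^ 2 + (2 * (y - i)) ^ 2 - (1 / ((i : ℝ) + 2)) ^ 2
    = (2 * (i - y) - r) * (2 * (i - y) + r) := by linarith
  have h4 : 0 < 2 * (i - y) + r := by linarith
  rw [h3, mul_nonneg_iff_of_pos_right h4, mul_eq_zero, or_iff_left h4.ne']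
  constructor <;> constructor <;> intro h <;> linarith

theorem lt_holeTop {i : ℕ} (hi : i ≠ 0) {X : ℝ} (hXi : X ^ 2 < (1 / ((i : ℝ) + 2)) ^ 2) :
    (i : ℝ) < holeTop i X := by
  have h2 : 0 < √((1 / ((i : ℝ) + 2)) ^ 2 - X ^ 2) := Real.sqrt_pos.2 (sub_pos.2 hXi)
  rw [holeTop, if_neg hi]; linarith

theorem holeBot_lt {i : ℕ} {X : ℝ} (hXi : X ^ 2 < (1 / ((i : ℝ) + 2)) ^ 2) :
    holeBot i X < i := by
  have h2 : 0 < √((1 / ((i : ℝ) + 2)) ^ 2 - X ^ 2) := Real.sqrt_pos.2 (sub_pos.2 hXi)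
  rw [holeBot]; linarith

theorem hole_pos_above {i j : ℕ} (h : j < i) {u : Circle} {y : ℝ} (hy : (i : ℝ) ≤ y) :
    0 < hole j u y := by
  have : (j : ℝ) + 1 ≤ i := by exact_mod_cast h
  exact hole_pos_of_far (by nlinarith)

theorem hole_pos_below {k j : ℕ} (h : k < j) {u : Circle} {y : ℝ} (hy : y ≤ (k : ℝ)) :
    0 < hole j u y := by
  have : (k : ℝ) + 1 ≤ j := by exact_mod_cast h
  exact hole_pos_of_far (by nlinarith)

/-- For `1 / (i+3) < X < 1 / (i+2)`, the vertical strip on the right that joins hole `i` to the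
outer boundary, missing the holes above. -/
def stripA (g i : ℕ) (hi : i < g) : Strip g where
  left := (2 * (1 / ((i : ℝ) + 3)) + 1 / ((i : ℝ) + 2)) / 3
  right := (1 / ((i : ℝ) + 3) + 2 * (1 / ((i : ℝ) + 2))) / 3
  lo := holeTop i
  hi := fun _ => g
  bot := if i = 0 then -1 else i
  top := g + 1
  neg_one_lt := by
    have : 0 < 1 / ((i : ℝ) + 3) := by positivity
    have := rad_pos i
    linarith
  left_lt := by
    have := rad_strictAnti i
    linarith
  right_lt := by
    have := rad_strictAnti i
    have := rad_le_half i
    linarith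
  lo_cont := continuous_holeTop i
  hi_cont := continuous_const
  lo_lt_hi X _ := by
    have h : (i : ℝ) + 1 ≤ g := by exact_mod_cast hi
    have := (holeTop_le i X).2
    linarith
  bot_lt X hX := by
    split_ifs with h
    · rw [holeTop, if_pos h]; norm_num
    · apply lt_holeTop h
      have h0 : 0 < 1 / ((i : ℝ) + 3) := by positivity
      have h1 := rad_pos i
      have h2 := rad_strictAnti i
      have h3 := hX.1
      have h4 := hX.2
      apply pow_lt_pow_left₀ _ _ two_ne_zero <;> linarith
  lt_top X _ := by linarith
  mem_iff X hX y hy := by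
    have h0 : 0 < 1 / ((i : ℝ) + 3) := by positivity
    have h1 := rad_pos i
    have h2 := rad_strictAnti i
    have h3 := hX.1
    have h4 := hX.2
    have hh := rad_le_half i
    have hX1 : X ∈ Ioo (-1 : ℝ) 1 := ⟨by linarith, by linarith⟩
    have hXi : X ^ 2 < (1 / ((i : ℝ) + 2)) ^ 2 := by
      apply pow_lt_pow_left₀ _ _ two_ne_zero <;> linarith
    have hgt : ∀ j, i < j → 0 < hole j (xi X) y := by
      intro j hj
      have h5 := rad_anti (i := i + 1) (j := j) hj
      push_cast at h5
      rw [show (i : ℝ) + 1 + 2 = i + 3 by ring] at h5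
      have h6 := rad_pos j
      rw [hole_xi j hX1]
      have : (1 / ((j : ℝ) + 2)) ^ 2 < X ^ 2 := by
        apply pow_lt_pow_left₀ _ _ two_ne_zero <;> linarith
      nlinarith [sq_nonneg (2 * (y - j))]
    constructor
    · rintro ⟨h5, h6, h7⟩
      refine ⟨?_, h6⟩
      by_cases h : i = 0
      · rw [holeTop, if_pos h]; exact h5
      · have h8 : (i : ℝ) < y := by simpa [h] using hy.1
        exact (hole_top h hX1 hXi h8.le).1.1
          (h7 i (Finset.mem_Ico.2 ⟨Nat.one_le_iff_ne_zero.2 h, hi⟩))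
    · rintro ⟨h5, h6⟩
      have h7 := (holeTop_le i X).1
      have h8 : (i : ℝ) ≤ y := h7.trans h5
      refine ⟨(Nat.cast_nonneg i).trans h8, h6, fun j hj => ?_⟩
      rcases lt_trichotomy j i with h | h | h
      · exact (hole_pos_above h h8).le
      · subst h
        have hj0 : j ≠ 0 := Nat.one_le_iff_ne_zero.1 (Finset.mem_Ico.1 hj).1
        exact (hole_top hj0 hX1 hXi h8).1.2 h5
      · exact (hgt j h).le
  edge_iff X hX y hy := by
    have h0 : 0 < 1 / ((i : ℝ) + 3) := by positivity
    have h1 := rad_pos i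
    have h2 := rad_strictAnti i
    have h3 := hX.1
    have h4 := hX.2
    have hh := rad_le_half i
    have hX1 : X ∈ Ioo (-1 : ℝ) 1 := ⟨by linarith, by linarith⟩
    have hXi : X ^ 2 < (1 / ((i : ℝ) + 2)) ^ 2 := by
      apply pow_lt_pow_left₀ _ _ two_ne_zero <;> linarith
    have hgt : ∀ j, i < j → 0 < hole j (xi X) y := by
      intro j hj
      have h5 := rad_anti (i := i + 1) (j := j) hj
      push_cast at h5
      rw [show (i : ℝ) + 1 + 2 = i + 3 by ring] at h5
      have h6 := rad_pos j
      rw [hole_xi j hX1]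
      have : (1 / ((j : ℝ) + 2)) ^ 2 < X ^ 2 := by
        apply pow_lt_pow_left₀ _ _ two_ne_zero <;> linarith
      nlinarith [sq_nonneg (2 * (y - j))]
    have h7 := (holeTop_le i X).1
    have h8 : (i : ℝ) ≤ y := h7.trans hy.1
    rw [edge_eq_zero_iff]
    constructor
    · rintro (h | h | ⟨j, hj, h⟩)
      · left
        have : i = 0 := by
          rw [h] at h8
          exact_mod_cast le_antisymm h8 (Nat.cast_nonneg i)
        rw [holeTop, if_pos this, h]
      · exact Or.inr h
      · left
        rcases lt_trichotomy j i with h' | h' | h'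
        · exact absurd h (hole_pos_above h' h8).ne'
        · subst h'
          have hj0 : j ≠ 0 := Nat.one_le_iff_ne_zero.1 (Finset.mem_Ico.1 hj).1
          exact (hole_top hj0 hX1 hXi h8).2.1 h
        · exact absurd h (hgt j h').ne'
    · rintro (h | h)
      · by_cases h' : i = 0
        · left; rw [h, holeTop, if_pos h']
        · right; right
          exact ⟨i, Finset.mem_Ico.2 ⟨Nat.one_le_iff_ne_zero.2 h', hi⟩,
            (hole_top h' hX1 hXi h8).2.2 h⟩
      · exact Or.inr (Or.inl h)

/-- For `|X| ≤ 1 / (2 (i+3))`, the vertical strip that joins hole `i` to hole `i + 1`. -/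
def stripC (g i : ℕ) (hi : i + 1 < g) : Strip g where
  left := -(1 / ((i : ℝ) + 3)) / 2
  right := 1 / ((i : ℝ) + 3) / 2
  lo := holeTop i
  hi := holeBot (i + 1)
  bot := if i = 0 then -1 else i
  top := ((i + 1 : ℕ) : ℝ)
  neg_one_lt := by
    have := rad_strictAnti i
    have := rad_le_half i
    linarith
  left_lt := by
    have : 0 < 1 / ((i : ℝ) + 3) := by positivity
    linarith
  right_lt := by
    have := rad_strictAnti i
    have := rad_le_half i
    linarith
  lo_cont := continuous_holeTop i
  hi_cont := continuous_holeBot (i + 1)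
  lo_lt_hi X _ := by
    have h1 := (holeTop_le i X).2
    have h2 := (holeBot_le (i + 1) X).1
    push_cast at h2
    linarith
  bot_lt X hX := by
    split_ifs with h
    · rw [holeTop, if_pos h]; norm_num
    · apply lt_holeTop h
      have h0 : 0 < 1 / ((i : ℝ) + 3) := by positivity
      have h2 := rad_strictAnti i
      have h3 := hX.1
      have h4 := hX.2
      apply sq_lt_sq' <;> linarith
  lt_top X hX := by
    apply holeBot_lt
    have h0 : 0 < 1 / ((i : ℝ) + 3) := by positivity
    have h3 := hX.1
    have h4 := hX.2
    push_cast
    rw [show (i : ℝ) + 1 + 2 = i + 3 by ring]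
    apply sq_lt_sq' <;> linarith
  mem_iff X hX y hy := by
    have h0 : 0 < 1 / ((i : ℝ) + 3) := by positivity
    have h2 := rad_strictAnti i
    have hh := rad_le_half i
    have h3 := hX.1
    have h4 := hX.2
    have hX1 : X ∈ Ioo (-1 : ℝ) 1 := ⟨by linarith, by linarith⟩
    have hXi : X ^ 2 < (1 / ((i : ℝ) + 2)) ^ 2 := by apply sq_lt_sq' <;> linarith
    have hXk : X ^ 2 < (1 / (((i + 1 : ℕ) : ℝ) + 2)) ^ 2 := by
      push_cast
      rw [show (i : ℝ) + 1 + 2 = i + 3 by ring]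
      apply sq_lt_sq' <;> linarith
    have hyk : y ≤ ((i + 1 : ℕ) : ℝ) := hy.2.le
    have hyg : y ≤ g := hyk.trans (by exact_mod_cast hi.le)
    constructor
    · rintro ⟨h5, h6, h7⟩
      refine ⟨?_, (hole_bot hX1 hXk hyk).1.1 (h7 _ (Finset.mem_Ico.2 ⟨by lia, hi⟩))⟩
      by_cases h : i = 0
      · rw [holeTop, if_pos h]; exact h5
      · have h8 : (i : ℝ) < y := by simpa [h] using hy.1
        exact (hole_top h hX1 hXi h8.le).1.1
          (h7 i (Finset.mem_Ico.2 ⟨Nat.one_le_iff_ne_zero.2 h, by lia⟩))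
    · rintro ⟨h5, h6⟩
      have h7 := (holeTop_le i X).1
      have h8 : (i : ℝ) ≤ y := h7.trans h5
      refine ⟨(Nat.cast_nonneg i).trans h8, hyg, fun j hj => ?_⟩
      rcases lt_trichotomy j i with h | h | h
      · exact (hole_pos_above h h8).le
      · subst h
        have hj0 : j ≠ 0 := Nat.one_le_iff_ne_zero.1 (Finset.mem_Ico.1 hj).1
        exact (hole_top hj0 hX1 hXi h8).1.2 h5
      · rcases (Nat.succ_le_of_lt h).eq_or_lt with h' | h'
        · subst h'
          exact (hole_bot hX1 hXk hyk).1.2 h6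
        · exact (hole_pos_below h' hyk).le
  edge_iff X hX y hy := by
    have h0 : 0 < 1 / ((i : ℝ) + 3) := by positivity
    have h2 := rad_strictAnti i
    have hh := rad_le_half i
    have h3 := hX.1
    have h4 := hX.2
    have hX1 : X ∈ Ioo (-1 : ℝ) 1 := ⟨by linarith, by linarith⟩
    have hXi : X ^ 2 < (1 / ((i : ℝ) + 2)) ^ 2 := by apply sq_lt_sq' <;> linarith
    have hXk : X ^ 2 < (1 / (((i + 1 : ℕ) : ℝ) + 2)) ^ 2 := by
      push_cast
      rw [show (i : ℝ) + 1 + 2 = i + 3 by ring]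
      apply sq_lt_sq' <;> linarith
    have hyk : y < ((i + 1 : ℕ) : ℝ) := hy.2.trans_lt (holeBot_lt hXk)
    have hyg : y < g := hyk.trans (by exact_mod_cast hi)
    have h7 := (holeTop_le i X).1
    have h8 : (i : ℝ) ≤ y := h7.trans hy.1
    rw [edge_eq_zero_iff]
    constructor
    · rintro (h | h | ⟨j, hj, h⟩)
      · left
        have : i = 0 := by
          rw [h] at h8
          exact_mod_cast le_antisymm h8 (Nat.cast_nonneg i)
        rw [holeTop, if_pos this, h]
      · exact absurd h hyg.ne
      · rcases lt_trichotomy j i with h' | h' | h'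
        · exact absurd h (hole_pos_above h' h8).ne'
        · subst h'
          have hj0 : j ≠ 0 := Nat.one_le_iff_ne_zero.1 (Finset.mem_Ico.1 hj).1
          exact Or.inl ((hole_top hj0 hX1 hXi h8).2.1 h)
        · rcases (Nat.succ_le_of_lt h').eq_or_lt with h9 | h9
          · subst h9
            exact Or.inr ((hole_bot hX1 hXk hyk.le).2.1 h)
          · exact absurd h (hole_pos_below h9 hyk.le).ne'
    · rintro (h | h)
      · by_cases h' : i = 0
        · left; rw [h, holeTop, if_pos h']
        · right; right
          exact ⟨i, Finset.mem_Ico.2 ⟨Nat.one_le_iff_ne_zero.2 h', by lia⟩,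
            (hole_top h' hX1 hXi h8).2.2 h⟩
      · right; right
        exact ⟨i + 1, Finset.mem_Ico.2 ⟨by lia, hi⟩, (hole_bot hX1 hXk hyk.le).2.2 h⟩

theorem edge_pos {g : ℕ} {u : Circle} {y : ℝ} (h0 : 0 < y) (hg : y < g)
    (h : ∀ j ∈ Finset.Ico 1 g, 0 < hole j u y) : (u, y) ∈ Plan g ∧ 0 < edge g u y :=
  ⟨⟨h0.le, hg.le, fun j hj => (h j hj).le⟩,
    mul_pos (mul_pos h0 (sub_pos.2 hg)) (Finset.prod_pos h)⟩

/-- The radii of the circles around hole `j`, in the coordinates `X`, `2 (y - j)`; the hole itself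
has radius `1 / (j+2)`. -/
def radB (j : ℕ) (t : ℝ) : ℝ := 1 / ((j : ℝ) + 2) + (1 - 1 / ((j : ℝ) + 2)) * ((1 + t) / 3)

theorem radB_mem (j : ℕ) {t : ℝ} (ht : t ∈ Icc (0 : ℝ) 1) :
    1 / ((j : ℝ) + 2) < radB j t ∧ radB j t < 1 := by
  have h1 := rad_le_half j
  have h2 := ht.1
  have h3 := ht.2
  unfold radB
  constructor <;> nlinarith

theorem radB_bounds {r : ℝ} {w : Circle} (h0 : 0 < r) (h1 : r < 1) :
    r * (w : ℂ).re ∈ Ioo (-1 : ℝ) 1 ∧ r * (w : ℂ).im ∈ Ioo (-1 : ℝ) 1 ∧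
      (r * (w : ℂ).re) ^ 2 + (r * (w : ℂ).im) ^ 2 = r ^ 2 := by
  have h := sq_add_sq w
  have h2 : (r * (w : ℂ).re) ^ 2 + (r * (w : ℂ).im) ^ 2 = r ^ 2 := by
    rw [mul_pow, mul_pow, ← mul_add, h, mul_one]
  have h3 : r ^ 2 < 1 := by nlinarith
  refine ⟨abs_lt.1 ?_, abs_lt.1 ?_, h2⟩ <;> rw [← sq_lt_one_iff_abs_lt_one] <;>
    nlinarith [sq_nonneg (r * (w : ℂ).re), sq_nonneg (r * (w : ℂ).im)]

theorem planB {g j : ℕ} (hj : j ∈ Finset.Ico 1 g) {X Y : ℝ} (hX : X ∈ Ioo (-1 : ℝ) 1)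
    (hY : Y ∈ Ioo (-1 : ℝ) 1) (hr : (1 / ((j : ℝ) + 2)) ^ 2 < X ^ 2 + Y ^ 2) :
    (xi X, j + Y / 2) ∈ Plan g ∧ 0 < edge g (xi X) (j + Y / 2) := by
  obtain ⟨h1, h2⟩ := Finset.mem_Ico.1 hj
  have h1 : (1 : ℝ) ≤ j := by exact_mod_cast h1
  have h2 : (j : ℝ) + 1 ≤ g := by exact_mod_cast h2
  have h3 := hY.1
  have h4 := hY.2
  refine edge_pos (by linarith) (by linarith) fun k _ => ?_
  rcases lt_trichotomy k j with h | h | h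
  · have : (k : ℝ) + 1 ≤ j := by exact_mod_cast h
    exact hole_pos_of_far (by nlinarith)
  · subst h
    rw [hole_xi k hX]
    have : (2 * ((k : ℝ) + Y / 2 - k)) ^ 2 = Y ^ 2 := by ring
    linarith
  · have : (j : ℝ) + 1 ≤ k := by exact_mod_cast h
    exact hole_pos_of_far (by nlinarith)

theorem planB' {g j : ℕ} (hj : j ∈ Finset.Ico 1 g) (a : Circle × unitInterval) :
    (xi (radB j a.2 * (a.1 : ℂ).re), j + radB j a.2 * (a.1 : ℂ).im / 2) ∈ Plan g ∧
      0 < edge g (xi (radB j a.2 * (a.1 : ℂ).re)) (j + radB j a.2 * (a.1 : ℂ).im / 2) := by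
  have h1 := radB_mem j a.2.2
  have h0 := rad_pos j
  obtain ⟨h2, h3, h4⟩ := radB_bounds (w := a.1) (h0.trans h1.1) h1.2
  refine planB hj h2 h3 ?_
  rw [h4]
  exact pow_lt_pow_left₀ h1.1 h0.le two_ne_zero

/-- The annulus around hole `j`, `1 ≤ j < g`, on the front. -/
def mapB (g j : ℕ) (hj : j ∈ Finset.Ico 1 g) : C(Circle × unitInterval, Surf g) where
  toFun a := ⟨(xi (radB j a.2 * (a.1 : ℂ).re), j + radB j a.2 * (a.1 : ℂ).im / 2,
    √(edge g (xi (radB j a.2 * (a.1 : ℂ).re)) (j + radB j a.2 * (a.1 : ℂ).im / 2))),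
    (planB' hj a).1, Real.sq_sqrt (planB' hj a).2.le⟩
  continuous_toFun := by
    have h1 : Continuous fun a : Circle × unitInterval => xi (radB j a.2 * (a.1 : ℂ).re) := by
      unfold radB
      exact continuous_xi.comp (by fun_prop)
    have h2 : Continuous fun a : Circle × unitInterval =>
        (j : ℝ) + radB j a.2 * (a.1 : ℂ).im / 2 := by
      unfold radB
      fun_prop
    have h3 := (continuous_edge g).comp (h1.prodMk h2)
    exact (h1.prodMk (h2.prodMk h3.sqrt)).subtype_mk _

theorem radB_strictMono (j : ℕ) : StrictMono (radB j) := by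
  intro s t h
  have := rad_le_half j
  unfold radB
  nlinarith

theorem mapB_injective (g j : ℕ) (hj : j ∈ Finset.Ico 1 g) : Function.Injective (mapB g j hj) := by
  intro a b h
  have ha := radB_mem j a.2.2
  have hb := radB_mem j b.2.2
  have h0 := rad_pos j
  obtain ⟨a1, a2, a3⟩ := radB_bounds (w := a.1) (h0.trans ha.1) ha.2
  obtain ⟨b1, b2, b3⟩ := radB_bounds (w := b.1) (h0.trans hb.1) hb.2
  have hx : xi (radB j a.2 * (a.1 : ℂ).re) = xi (radB j b.2 * (b.1 : ℂ).re) :=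
    congrArg (fun p : Surf g => p.1.1) h
  have hy : (j : ℝ) + radB j a.2 * (a.1 : ℂ).im / 2 = j + radB j b.2 * (b.1 : ℂ).im / 2 :=
    congrArg (fun p : Surf g => p.1.2.1) h
  have hx' : radB j a.2 * (a.1 : ℂ).re = radB j b.2 * (b.1 : ℂ).re := by
    rw [← chi_xi a1, hx, chi_xi b1]
  have hy' : radB j a.2 * (a.1 : ℂ).im = radB j b.2 * (b.1 : ℂ).im := by linarith
  have hr : radB j a.2 = radB j b.2 := by
    rw [hx', hy', b3] at a3
    exact (pow_left_inj₀ (h0.trans hb.1).le (h0.trans ha.1).le two_ne_zero).1 a3 |>.symm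
  have hp : radB j b.2 ≠ 0 := (h0.trans hb.1).ne'
  rw [hr] at hx' hy'
  exact Prod.ext (Circle.ext (Complex.ext (mul_left_cancel₀ hp hx') (mul_left_cancel₀ hp hy')))
    (Subtype.ext ((radB_strictMono j).injective hr))

theorem mapB_image (g j : ℕ) (hj : j ∈ Finset.Ico 1 g) :
    mapB g j hj '' {a | (a.2 : ℝ) ∈ Ioo (0 : ℝ) 1} =
    {p : Surf g | 0 < (p.1.1 : ℂ).re ∧ (chi p.1.1, p.1.2.1, p.1.2.2) ∈
      {q : ℝ × ℝ × ℝ | 0 < q.2.2 ∧ (radB j 0 ^ 2 < q.1 ^ 2 + (2 * (q.2.1 - j)) ^ 2 ∧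
        q.1 ^ 2 + (2 * (q.2.1 - j)) ^ 2 < radB j 1 ^ 2)}} := by
  have h0 := rad_pos j
  have hr0 := radB_mem j (t := 0) ⟨le_rfl, zero_le_one⟩
  have hr1 := radB_mem j (t := 1) ⟨zero_le_one, le_rfl⟩
  have h01 := radB_strictMono j zero_lt_one
  apply Subset.antisymm
  · rintro _ ⟨a, ⟨ht0, ht1⟩, rfl⟩
    have ha := radB_mem j a.2.2
    obtain ⟨a1, a2, a3⟩ := radB_bounds (w := a.1) (h0.trans ha.1) ha.2
    change 0 < (xi (radB j a.2 * (a.1 : ℂ).re) : ℂ).re ∧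
      0 < √(edge g (xi (radB j a.2 * (a.1 : ℂ).re)) (j + radB j a.2 * (a.1 : ℂ).im / 2)) ∧
      (radB j 0 ^ 2 < chi (xi (radB j a.2 * (a.1 : ℂ).re)) ^ 2 +
        (2 * (j + radB j a.2 * (a.1 : ℂ).im / 2 - j)) ^ 2 ∧
      chi (xi (radB j a.2 * (a.1 : ℂ).re)) ^ 2 +
        (2 * (j + radB j a.2 * (a.1 : ℂ).im / 2 - j)) ^ 2 < radB j 1 ^ 2)
    have e : (2 * (j + radB j a.2 * (a.1 : ℂ).im / 2 - j)) ^ 2 =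
      (radB j a.2 * (a.1 : ℂ).im) ^ 2 := by ring
    rw [xi_re a1, chi_xi a1, e, a3]
    refine ⟨by nlinarith [a1.1, a1.2], Real.sqrt_pos.2 (planB' hj a).2, ?_, ?_⟩
    · exact pow_lt_pow_left₀ (radB_strictMono j ht0) (h0.trans hr0.1).le two_ne_zero
    · exact pow_lt_pow_left₀ (radB_strictMono j ht1) (h0.trans ha.1).le two_ne_zero
  · rintro ⟨⟨u, y, z⟩, hP, hz⟩ ⟨hu, hz0, hl, hr⟩
    simp only at hP hz hu hz0 hl hr
    set X := chi u with hX
    set Y := 2 * (y - j) with hY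
    have hN0 : 0 ≤ X ^ 2 + Y ^ 2 := by positivity
    set N := √(X ^ 2 + Y ^ 2) with hN
    have hNs : N ^ 2 = X ^ 2 + Y ^ 2 := Real.sq_sqrt hN0
    rw [← hNs] at hl hr
    have hl' : radB j 0 < N := lt_of_pow_lt_pow_left₀ 2 (Real.sqrt_nonneg _) hl
    have hr' : N < radB j 1 := lt_of_pow_lt_pow_left₀ 2 (h0.trans hr1.1).le hr
    have hNp : 0 < N := (h0.trans hr0.1).trans hl'
    have hd : 0 < radB j 1 - radB j 0 := by linarith
    have hT0 : 0 < (N - radB j 0) / (radB j 1 - radB j 0) := div_pos (by linarith) hd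
    have hT1 : (N - radB j 0) / (radB j 1 - radB j 0) < 1 := (div_lt_one hd).2 (by linarith)
    let t : unitInterval := ⟨_, hT0.le, hT1.le⟩
    have ht : radB j t = N := by
      have e : ∀ s : ℝ, radB j s = radB j 0 + s * (radB j 1 - radB j 0) := by
        intro s; unfold radB; ring
      rw [e]
      change radB j 0 + (N - radB j 0) / (radB j 1 - radB j 0) * (radB j 1 - radB j 0) = N
      rw [div_mul_cancel₀ _ hd.ne']; ring
    obtain ⟨w, hw1, hw2⟩ := exists_circle (c := X / N) (d := Y / N) (by
      rw [div_pow, div_pow, ← add_div, ← hNs, div_self (by positivity)])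
    have e1 : radB j t * (w : ℂ).re = X := by rw [ht, hw1, mul_div_cancel₀ _ hNp.ne']
    have e2 : (j : ℝ) + radB j t * (w : ℂ).im / 2 = y := by
      rw [ht, hw2, mul_div_cancel₀ _ hNp.ne', hY]; ring
    refine ⟨(w, t), ⟨hT0, hT1⟩, Subtype.ext ?_⟩
    change (xi (radB j t * (w : ℂ).re), (j : ℝ) + radB j t * (w : ℂ).im / 2,
      √(edge g (xi (radB j t * (w : ℂ).re)) (j + radB j t * (w : ℂ).im / 2))) = (u, y, z)
    rw [e1, e2, hX, xi_chi, ← hz, Real.sqrt_sq hz0.le]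

/-- The annulus around hole `j`, `1 ≤ j < g`, on the front. -/
def annulusB (g j : ℕ) (hj : j ∈ Finset.Ico 1 g) : Annulus (Surf g) where
  toMap := mapB g j hj
  inj := mapB_injective g j hj
  isOpen_interior := by
    rw [mapB_image]
    refine isOpen_chart (IsOpen.and ?_ (IsOpen.and ?_ ?_)) <;>
      exact isOpen_lt (by fun_prop) (by fun_prop)

theorem planE {g n : ℕ} (hn : n + 1 < g) (u : Circle) {t : ℝ} (ht : t ∈ Icc (0 : ℝ) 1)
    (hn0 : 1 ≤ n) :
    (u, n + (1 + t) / 3) ∈ Plan g ∧ 0 < edge g u (n + (1 + t) / 3) := by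
  have h1 := ht.1
  have h2 := ht.2
  have h3 : (1 : ℝ) ≤ n := by exact_mod_cast hn0
  have h4 : (n : ℝ) + 2 ≤ g := by exact_mod_cast hn
  refine edge_pos (by linarith) (by linarith) fun k hk => ?_
  have hr := rad_pos k
  have hh := rad_le_half k
  have hu := circle_re_le u
  have hk3 : (1 / ((k : ℝ) + 2)) ≤ 1 / 3 := by
    have : (1 : ℝ) ≤ k := by exact_mod_cast (Finset.mem_Ico.1 hk).1
    apply one_div_le_one_div_of_le <;> linarith
  have key : 1 / 9 ≤ ((n : ℝ) + (1 + t) / 3 - k) ^ 2 := by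
    rcases le_or_gt k n with h | h
    · have : (k : ℝ) ≤ n := by exact_mod_cast h
      nlinarith
    · have : (n : ℝ) + 1 ≤ k := by exact_mod_cast h
      nlinarith
  unfold hole
  nlinarith

/-- The annulus on the front that separates the holes `0, …, n` from the remaining holes and from
the outer boundary; `t` runs upwards and `w` runs to the left. -/
def mapE (g n : ℕ) (hn : 1 ≤ n ∧ n + 1 < g) : C(Circle × unitInterval, Surf g) where
  toFun a := ⟨(a.1⁻¹, n + (1 + a.2) / 3, √(edge g a.1⁻¹ (n + (1 + a.2) / 3))),
    (planE hn.2 _ a.2.2 hn.1).1, Real.sq_sqrt (planE hn.2 _ a.2.2 hn.1).2.le⟩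
  continuous_toFun := by
    have h1 : Continuous fun a : Circle × unitInterval => a.1⁻¹ := by fun_prop
    have h2 : Continuous fun a : Circle × unitInterval => (n : ℝ) + (1 + a.2) / 3 := by fun_prop
    have h3 := (continuous_edge g).comp (h1.prodMk h2)
    exact (h1.prodMk (h2.prodMk h3.sqrt)).subtype_mk _

/-- The annulus `mapE`. -/
def annulusE (g n : ℕ) (hn : 1 ≤ n ∧ n + 1 < g) : Annulus (Surf g) where
  toMap := mapE g n hn
  inj a b h := by
    have hx : a.1⁻¹ = b.1⁻¹ := congrArg (fun p : Surf g => p.1.1) h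
    have hy : (n : ℝ) + (1 + a.2) / 3 = n + (1 + b.2) / 3 :=
      congrArg (fun p : Surf g => p.1.2.1) h
    exact Prod.ext (inv_injective hx) (Subtype.ext (by linarith))
  isOpen_interior := by
    have : mapE g n hn '' {a | (a.2 : ℝ) ∈ Ioo (0 : ℝ) 1} =
        {p : Surf g | 0 < p.1.2.2 ∧ ((n : ℝ) + 1 / 3 < p.1.2.1 ∧ p.1.2.1 < n + 2 / 3)} := by
      apply Subset.antisymm
      · rintro _ ⟨a, ⟨h0, h1⟩, rfl⟩
        refine ⟨Real.sqrt_pos.2 (planE hn.2 _ a.2.2 hn.1).2, ?_, ?_⟩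
        · change (n : ℝ) + 1 / 3 < n + (1 + a.2) / 3
          linarith
        · change (n : ℝ) + (1 + a.2) / 3 < n + 2 / 3
          linarith
      · rintro ⟨⟨u, y, z⟩, hP, hz⟩ ⟨h1, h2, h3⟩
        simp only at hP hz h1 h2 h3
        refine ⟨(u⁻¹, ⟨3 * (y - n) - 1, by linarith, by linarith⟩), ⟨?_, ?_⟩, Subtype.ext ?_⟩
        · change (0 : ℝ) < 3 * (y - n) - 1
          linarith
        · change 3 * (y - n) - 1 < (1 : ℝ)
          linarith
        · change (u⁻¹⁻¹, (n : ℝ) + (1 + (3 * (y - n) - 1)) / 3,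
            √(edge g u⁻¹⁻¹ (n + (1 + (3 * (y - n) - 1)) / 3))) = (u, y, z)
          have e : (n : ℝ) + (1 + (3 * (y - n) - 1)) / 3 = y := by ring
          rw [e, inv_inv, ← hz, Real.sqrt_sq h1.le]
    rw [this]
    refine IsOpen.and ?_ (IsOpen.and ?_ ?_) <;> exact isOpen_lt (by fun_prop) (by fun_prop)

/-! ### The generators

`T_{a_1}, …, T_{a_g}`, `T_{b_2}, …, T_{b_g}`, `T_{c_1}, …, T_{c_{g-1}}`, the bounding pair maps
`T_{α_n} T_{ι(α_n)}⁻¹` for `1 ≤ n ≤ g - 2`, and the hyperelliptic involution `ι`. The curves are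
numbered from `1` and the holes from `0`, so that `a_{i+1}`, `b_{i+1}` belong to hole `i`. -/

/-- The twist about `a_{i+1}`, the double of an arc from hole `i` to the outer boundary. -/
def twistA (g i : ℕ) (hi : i < g) : Surf g ≃ₜ Surf g := dehnTwist (stripA g i hi).annulus

/-- The twist about `b_{i+1}`, the curve around hole `i`. -/
def twistB (g i : ℕ) (hi : i ∈ Finset.Ico 1 g) : Surf g ≃ₜ Surf g := dehnTwist (annulusB g i hi)

/-- The twist about `c_{i+1}`, the double of an arc from hole `i` to hole `i + 1`. -/
def twistC (g i : ℕ) (hi : i + 1 < g) : Surf g ≃ₜ Surf g := dehnTwist (stripC g i hi).annulus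

/-- The bounding pair map `T_{α_n} T_{ι(α_n)}⁻¹`, where `α_n` is the curve on the front that
encircles the first `n + 1` holes. -/
def boundingPair (g n : ℕ) (hn : 1 ≤ n ∧ n + 1 < g) : Surf g ≃ₜ Surf g :=
  dehnTwist (annulusE g n hn) * (dehnTwist ((annulusE g n hn).map (hyperelliptic g)))⁻¹

/-- The set of generators of the liftable mapping class group of `cover g`. -/
def generators (g : ℕ) : Set (MCG (Surf g)) :=
  {F | (∃ i hi, F = cls (twistA g i hi)) ∨ (∃ i hi, F = cls (twistB g i hi)) ∨
    (∃ i hi, F = cls (twistC g i hi)) ∨ (∃ n hn, F = cls (boundingPair g n hn)) ∨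
    F = cls (hyperelliptic g)}

end LadderCover

end

noncomputable section

namespace LadderCover

open Set

/-! ### The effect of a homeomorphism on the angular coordinate -/

/-! The cover is the pullback of `Circle.exp` along the angular coordinate `u` of the surface, so
what a lift does to the handle shift is decided by what `f` does to the class of `u` in `H¹`.
`HasSign f ε` says that this class is multiplied by `ε = ±1`, in the concrete form `u ∘ f = u ^ ε *
exp φ` with `φ` real-valued and continuous. Signs multiply under composition, and homotopy lifting
makes them isotopy invariants, so they may be computed on the explicit representatives of the
generators.

The hyperelliptic involution inverts `u` and has sign `-1`. All other generators have sign `1`: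
twists supported over the half circle `0 < Re u` change `u` by a quantity with a continuous
logarithm, and a bounding pair map is a rotation by an angle that depends continuously on the height
alone (`boundingPair_fst`).

The link with lifts is `HasSign.lift_mul_handleShift`. Along a path from `p` to its translate, `2πx
∘ f'` and `ε · 2πx + φ` are logarithms of one and the same circle-valued function, hence differ by a
constant; as `φ` takes equal values at the two ends, `f'` carries translation by `1` to translation
by `ε`. A product with `k` factors `ι` has sign `(-1) ^ k`, and since the handle shift is not its
own inverse, exactly one of the two relations holds. -/

/-- The angular coordinate of `f` is that of the identity, raised to the power `ε = ±1`, up to a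
factor that has a continuous logarithm: the class of the angular coordinate in
`H¹(Surf g; ℤ)` is multiplied by `ε`. -/
def HasSign {g : ℕ} (f : Surf g ≃ₜ Surf g) (ε : ℤˣ) : Prop :=
  ∃ φ : Surf g → ℝ, Continuous φ ∧ ∀ p, (f p).1.1 = p.1.1 ^ (ε : ℤ) * Circle.exp (φ p)

theorem exp_zsmul (n : ℤ) (x : ℝ) : Circle.exp (n * x) = Circle.exp x ^ n := by
  simp [Circle.exp_zsmul, ← zsmul_eq_mul]

theorem HasSign.one (g : ℕ) : HasSign (1 : Surf g ≃ₜ Surf g) 1 :=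
  ⟨fun _ => 0, continuous_const, fun p => by simp⟩

theorem HasSign.mul {g : ℕ} {f k : Surf g ≃ₜ Surf g} {ε δ : ℤˣ} (hf : HasSign f ε)
    (hk : HasSign k δ) : HasSign (f * k) (ε * δ) := by
  obtain ⟨φ, hφ, hf⟩ := hf
  obtain ⟨ψ, hψ, hk⟩ := hk
  refine ⟨fun p => ((ε : ℤ) : ℝ) * ψ p + φ (k p), by fun_prop, fun p => ?_⟩
  rw [Homeomorph.mul_apply, hf, hk, mul_zpow, ← zpow_mul, ← exp_zsmul, mul_assoc, Circle.exp_add,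
    mul_comm (δ : ℤ), Units.val_mul]

/-- Because `ε` is its own inverse, `v = u ^ ε * exp φ` can be solved for `u` as `(v * exp (-φ)) ^
ε`, with the same exponent. -/
theorem HasSign.inv {g : ℕ} {f : Surf g ≃ₜ Surf g} {ε : ℤˣ} (hf : HasSign f ε) :
    HasSign f⁻¹ ε := by
  obtain ⟨φ, hφ, hf⟩ := hf
  refine ⟨fun p => ((ε : ℤ) : ℝ) * -φ (f.symm p),
    by have := f.symm.continuous; fun_prop, fun p => ?_⟩
  have h := hf (f.symm p)
  rw [f.apply_symm_apply] at h
  have hε : (ε : ℤ) * ε = 1 := by rw [← Units.val_mul, Int.units_mul_self]; rfl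
  rw [exp_zsmul, ← mul_zpow, h, Circle.exp_neg, mul_inv_cancel_right, ← zpow_mul, hε, zpow_one]
  rfl

/-- The quotient of the angular coordinates at time `t` and at time `0` is `1` at the start, so it
lifts through `Circle.exp` starting from `0`. The lift at time `1` is the correction to `φ`. -/
theorem HasSign.of_isotopic {g : ℕ} {f k : Surf g ≃ₜ Surf g} {ε : ℤˣ} (hf : HasSign f ε)
    (h : Isotopic f k) : HasSign k ε := by
  obtain ⟨φ, hφ, hf⟩ := hf
  obtain ⟨H⟩ := h
  let K : C(unitInterval × Surf g, Circle) :=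
    ⟨fun a => (f a.2).1.1⁻¹ * (H a).1.1, by fun_prop⟩
  have hK : ∀ p, K (0, p) = Circle.exp ((0 : C(Surf g, ℝ)) p) := fun p => by
    change (f p).1.1⁻¹ * (H (0, p)).1.1 = _
    rw [H.apply_zero]
    simp
  let Φ := Circle.isCoveringMap_exp.liftHomotopy K 0 hK
  refine ⟨fun p => φ p + Φ (1, p), by fun_prop, fun p => ?_⟩
  have h1 : Circle.exp (Φ (1, p)) = (f p).1.1⁻¹ * (H (1, p)).1.1 :=
    congrFun (Circle.isCoveringMap_exp.liftHomotopy_lifts K 0 hK) (1, p)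
  rw [H.apply_one] at h1
  rw [Circle.exp_add, ← mul_assoc, ← hf, h1]
  simp

theorem HasSign.of_cls_eq {g : ℕ} {f k : Surf g ≃ₜ Surf g} {ε : ℤˣ} (hf : HasSign f ε)
    (h : cls f = cls k) : HasSign k ε :=
  hf.of_isotopic ((Con.eq _).1 h)

/-! ### The signs of the generators -/

theorem hasSign_hyperelliptic (g : ℕ) : HasSign (hyperelliptic g) (-1) :=
  ⟨fun _ => 0, continuous_const, fun p => by
    change p.1.1⁻¹ = _
    simp⟩

theorem hyperelliptic_inv (g : ℕ) : (hyperelliptic g)⁻¹ = hyperelliptic g := rfl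

/-- A twist in an annulus over the half circle `0 < Re u` changes the angular coordinate by a
function that has a continuous logarithm. -/
theorem hasSign_dehnTwist {g : ℕ} (e : Annulus (Surf g))
    (he : ∀ a, 0 < ((e.toMap a).1.1 : ℂ).re) : HasSign (dehnTwist e) 1 := by
  -- Although `arg` jumps at `-1`, this difference is continuous: on the annulus both a point and
  -- its image lie over `0 < Re u`, where `arg` is continuous, and on the open complement the
  -- difference vanishes identically.
  refine ⟨fun p => ((dehnTwist e p).1.1 : ℂ).arg - (p.1.1 : ℂ).arg, ?_, fun p => ?_⟩
  · rw [continuous_iff_continuousAt]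
    intro p
    by_cases hp : p ∈ range e.toMap
    · obtain ⟨a, rfl⟩ := hp
      have h1 : (dehnTwist e (e.toMap a)) = e.toMap (stdTwist a) := e.extend_apply _ a
      refine ContinuousAt.sub ?_ ?_
      · refine ContinuousAt.comp (g := Complex.arg)
          (f := fun p : Surf g => ((dehnTwist e p).1.1 : ℂ)) (Complex.continuousAt_arg ?_)
          (by fun_prop)
        rw [h1]
        exact Or.inl (he _)
      · exact ContinuousAt.comp (g := Complex.arg) (f := fun p : Surf g => (p.1.1 : ℂ))
          (Complex.continuousAt_arg (Or.inl (he a))) (by fun_prop)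
    · have hE := (e.toMap.continuous.isClosedEmbedding e.inj).isClosed_range
      refine (continuousAt_const (y := (0 : ℝ))).congr ?_
      filter_upwards [hE.isOpen_compl.mem_nhds hp] with q hq
      have h1 : dehnTwist e q = q := e.extend_of_notMem _ fun a ha => hq ⟨a, ha⟩
      rw [h1, sub_self]
  · rw [Circle.exp_sub, Circle.exp_arg, Circle.exp_arg]
    simp

/-- In the chart `Re u = 1 - X ^ 2` with `|X| < 1`, which is positive. This settles the curves `a`
and `c` together. -/
theorem hasSign_strip {g : ℕ} (s : Strip g) : HasSign (dehnTwist s.annulus) 1 := by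
  refine hasSign_dehnTwist _ fun a => ?_
  have hm := s.mem_one (s.xc_mem a.2)
  change 0 < (xi (s.xc a.2) : ℂ).re
  rw [xi_re hm]
  nlinarith [hm.1, hm.2]

theorem hasSign_twistB {g j : ℕ} (hj : j ∈ Finset.Ico 1 g) : HasSign (twistB g j hj) 1 := by
  refine hasSign_dehnTwist _ fun a => ?_
  have hr := radB_mem j a.2.2
  have hm := (radB_bounds (w := a.1) ((rad_pos j).trans hr.1) hr.2).1
  change 0 < (xi (radB j a.2 * (a.1 : ℂ).re) : ℂ).re
  rw [xi_re hm]
  nlinarith [hm.1, hm.2]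

/-! ### The bounding pair maps as rotations by a height-dependent angle -/

/-- The twist angle, as a function of the height `y`, of the bounding pair map. -/
def ramp (n : ℕ) (y : ℝ) : ℝ := max 0 (min 1 (3 * (y - n) - 1))

theorem continuous_ramp (n : ℕ) : Continuous (ramp n) := by
  unfold ramp; fun_prop

theorem ramp_height (n : ℕ) (t : unitInterval) : ramp n (n + (1 + t) / 3) = t := by
  have e : 3 * ((n : ℝ) + (1 + t) / 3 - n) - 1 = t := by ring
  rw [ramp, e, min_eq_right t.2.2, max_eq_right t.2.1]

/-- Below the strip the ramp is clamped to no turn, above it to one full turn. Hence the rotation by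
`ramp` is the identity off the strip, while its angle stays continuous throughout. -/
theorem exp_ramp_eq_one {n : ℕ} {y : ℝ} (h : y ∉ Icc ((n : ℝ) + 1 / 3) (n + 2 / 3)) :
    Circle.exp (2 * Real.pi * ramp n y) = 1 := by
  rw [mem_Icc, not_and_or, not_le, not_le] at h
  unfold ramp
  rcases h with h | h
  · rw [max_eq_left (min_le_of_right_le (by linarith))]
    simp
  · rw [min_eq_left (by linarith), max_eq_right zero_le_one]
    simp

theorem mem_range_mapE {g n : ℕ} (hn : 1 ≤ n ∧ n + 1 < g) {p : Surf g} (hz : 0 ≤ p.1.2.2)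
    (hy : p.1.2.1 ∈ Icc ((n : ℝ) + 1 / 3) (n + 2 / 3)) :
    ∃ t : unitInterval, p.1.2.1 = n + (1 + t) / 3 ∧ mapE g n hn (p.1.1⁻¹, t) = p := by
  obtain ⟨⟨u, y, z⟩, hP, hz2⟩ := p
  simp only at hz hy hz2
  have e : y = (n : ℝ) + (1 + (3 * (y - n) - 1)) / 3 := by ring
  -- The parameter comes from solving `y = n + (1 + t) / 3` for `t`.
  refine ⟨⟨3 * (y - n) - 1, by linarith [hy.1], by linarith [hy.2]⟩, e, Subtype.ext ?_⟩
  change (u⁻¹⁻¹, (n : ℝ) + (1 + (3 * (y - n) - 1)) / 3,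
    √(edge g u⁻¹⁻¹ (n + (1 + (3 * (y - n) - 1)) / 3))) = (u, y, z)
  rw [← e, inv_inv, ← hz2, Real.sqrt_sq hz]

/-- The strip avoids the boundary of the planar domain, so `z ^ 2 = edge > 0` there. Front and back
are thus disjoint over the strip, and `ι` really exchanges the two supports. -/
theorem height_ne_zero_of_mem {g n : ℕ} (hn : 1 ≤ n ∧ n + 1 < g) {p : Surf g}
    (hy : p.1.2.1 ∈ Icc ((n : ℝ) + 1 / 3) (n + 2 / 3)) : p.1.2.2 ≠ 0 := by
  intro h
  have h1 := p.2.2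
  have h2 := (planE hn.2 p.1.1 (t := 3 * (p.1.2.1 - n) - 1)
    ⟨by linarith [hy.1], by linarith [hy.2]⟩ hn.1).2
  rw [show (n : ℝ) + (1 + (3 * (p.1.2.1 - n) - 1)) / 3 = p.1.2.1 by ring, ← h1, h] at h2
  simp at h2

/-- The twist in `annulusE` preserves heights and sides, and rotates the front by `ramp`. -/
theorem dehnTwist_annulusE {g n : ℕ} (hn : 1 ≤ n ∧ n + 1 < g) (p : Surf g) :
    (dehnTwist (annulusE g n hn) p).1.2.1 = p.1.2.1 ∧
      (0 ≤ (dehnTwist (annulusE g n hn) p).1.2.2 ↔ 0 ≤ p.1.2.2) ∧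
      (0 ≤ p.1.2.2 → (dehnTwist (annulusE g n hn) p).1.1 =
        p.1.1 * (Circle.exp (2 * Real.pi * ramp n p.1.2.1))⁻¹) ∧
      (¬0 ≤ p.1.2.2 → (dehnTwist (annulusE g n hn) p).1.1 = p.1.1) := by
  have hout : (∀ a, mapE g n hn a ≠ p) → dehnTwist (annulusE g n hn) p = p :=
    (annulusE g n hn).extend_of_notMem _
  by_cases hz : 0 ≤ p.1.2.2
  · by_cases hy : p.1.2.1 ∈ Icc ((n : ℝ) + 1 / 3) (n + 2 / 3)
    · obtain ⟨t, ht, hp⟩ := mem_range_mapE hn hz hy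
      have h1 : dehnTwist (annulusE g n hn) p = mapE g n hn (stdTwist (p.1.1⁻¹, t)) := by
        conv_lhs => rw [← hp]
        exact (annulusE g n hn).extend_apply _ _
      rw [h1, ht, ramp_height]
      refine ⟨rfl, iff_of_true (Real.sqrt_nonneg _) hz, fun _ => ?_, fun h => absurd hz h⟩
      -- The annulus is parametrised by `w = u⁻¹`, so the left twist in `w` turns `u` by the inverse
      -- factor.
      change (Circle.exp (2 * Real.pi * t) * p.1.1⁻¹)⁻¹ = _
      rw [mul_inv, inv_inv, mul_comm]
    · rw [hout, exp_ramp_eq_one hy]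
      · simp
      · rintro a rfl
        exact hy ⟨by change _ ≤ (n : ℝ) + (1 + a.2) / 3; linarith [a.2.2.1],
          by change (n : ℝ) + (1 + a.2) / 3 ≤ _; linarith [a.2.2.2]⟩
  · rw [hout]
    · simp [hz]
    · rintro a rfl
      exact hz (Real.sqrt_nonneg _)

theorem dehnTwist_map {X : Type*} [TopologicalSpace X] [T2Space X] (e : Annulus X) (k : X ≃ₜ X) :
    dehnTwist (e.map k) = k * dehnTwist e * k⁻¹ := by
  ext x
  obtain ⟨y, rfl⟩ := k.surjective x
  have hk : (k * dehnTwist e * k⁻¹) (k y) = k (dehnTwist e y) := by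
    change k (dehnTwist e (k.symm (k y))) = _
    rw [k.symm_apply_apply]
  rw [hk]
  change (e.map k).extend stdTwist (k y) = k (e.extend stdTwist y)
  by_cases H : ∃ a, e.toMap a = y
  · obtain ⟨a, rfl⟩ := H
    rw [e.extend_apply]
    exact (e.map k).extend_apply stdTwist a
  · push Not at H
    rw [e.extend_of_notMem _ H, (e.map k).extend_of_notMem]
    exact fun a ha => H a (k.injective ha)

/-- With `T = T_α`, `dehnTwist_map` turns the pair into `T * ι * T⁻¹ * ι`. On the back, `T⁻¹`
reverses the rotation and conjugation by `ι` reverses it again, so front and back turn by the same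
factor. For `T` alone the angle would be a full turn on the front and zero on the back above the
strip, with no continuous match along the boundary; the pair removes this discrepancy. -/
theorem boundingPair_fst {g n : ℕ} (hn : 1 ≤ n ∧ n + 1 < g) (p : Surf g) :
    (boundingPair g n hn p).1.1 = p.1.1 * (Circle.exp (2 * Real.pi * ramp n p.1.2.1))⁻¹ := by
  set T := dehnTwist (annulusE g n hn) with hT
  set s := T.symm (hyperelliptic g p) with hs
  have hb : boundingPair g n hn p = T (hyperelliptic g s) := by
    rw [boundingPair, dehnTwist_map, mul_inv_rev, mul_inv_rev, inv_inv]
    rfl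
  have hTs : T s = hyperelliptic g p := T.apply_symm_apply _
  obtain ⟨a1, a2, a3, a4⟩ := dehnTwist_annulusE hn s
  obtain ⟨b1, b2, b3, b4⟩ := dehnTwist_annulusE hn (hyperelliptic g s)
  rw [← hT, hTs] at a1 a2 a3 a4
  rw [← hT, ← hb] at b3 b4
  change p.1.2.1 = s.1.2.1 at a1
  change 0 ≤ -p.1.2.2 ↔ _ at a2
  change _ → p.1.1⁻¹ = _ at a3
  change _ → p.1.1⁻¹ = _ at a4
  change 0 ≤ -s.1.2.2 → _ = s.1.1⁻¹ * (Circle.exp (2 * Real.pi * ramp n s.1.2.1))⁻¹ at b3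
  change ¬0 ≤ -s.1.2.2 → _ = s.1.1⁻¹ at b4
  rw [← a1] at a3 b3
  -- Over the strip exactly one of the two twists acts: the one about `α` if `s` is on the back,
  -- that is `p` on the front, and the conjugated inverse otherwise. Off the strip every rotation
  -- factor is `1`.
  by_cases hy : p.1.2.1 ∈ Icc ((n : ℝ) + 1 / 3) (n + 2 / 3)
  · have hz := height_ne_zero_of_mem hn hy
    have hz' := height_ne_zero_of_mem hn (p := s) (a1 ▸ hy)
    rcases hz'.lt_or_gt with h | h
    · rw [b3 (by linarith), ← a4 (by linarith), inv_inv]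
    · rw [b4 (by linarith), ← inv_inv p.1.1, a3 h.le, mul_inv, inv_inv, mul_inv_cancel_right]
  · rw [exp_ramp_eq_one hy, inv_one, mul_one] at a3 b3 ⊢
    have ha : p.1.1⁻¹ = s.1.1 := by by_cases h : 0 ≤ s.1.2.2; exacts [a3 h, a4 h]
    rw [← inv_inv p.1.1, ha]
    by_cases h : 0 ≤ -s.1.2.2
    exacts [b3 h, b4 h]

theorem hasSign_boundingPair {g n : ℕ} (hn : 1 ≤ n ∧ n + 1 < g) :
    HasSign (boundingPair g n hn) 1 := by
  have := continuous_ramp n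
  refine ⟨fun p => -(2 * Real.pi * ramp n p.1.2.1), by fun_prop, fun p => ?_⟩
  rw [boundingPair_fst, Circle.exp_neg]
  simp

/-- A generator other than the class of the hyperelliptic involution has sign `1`. -/
theorem hasSign_of_mem_generators {g : ℕ} {f : Surf g ≃ₜ Surf g} (hf : cls f ∈ generators g)
    (hne : cls f ≠ cls (hyperelliptic g)) : HasSign f 1 := by
  rcases hf with ⟨i, hi, h⟩ | ⟨i, hi, h⟩ | ⟨i, hi, h⟩ | ⟨n, hn, h⟩ | h
  · exact (hasSign_strip _).of_cls_eq h.symm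
  · exact (hasSign_twistB hi).of_cls_eq h.symm
  · exact (hasSign_strip _).of_cls_eq h.symm
  · exact (hasSign_boundingPair hn).of_cls_eq h.symm
  · exact absurd h hne

-- As `ι` is its own inverse, `F⁻¹` is its class only if `F` is, so passing to inverses does not
-- disturb the case distinction. The test concerns the class `F` alone, so no generators need to be
-- told apart.
open Classical in
theorem hasSign_of_mem_or_inv_mem {g : ℕ} {F : MCG (Surf g)} {f : Surf g ≃ₜ Surf g}
    (hF : F ∈ generators g ∨ F⁻¹ ∈ generators g) (hf : cls f = F) :
    HasSign f (if F = cls (hyperelliptic g) then -1 else 1) := by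
  subst hf
  split_ifs with h
  · exact (hasSign_hyperelliptic g).of_cls_eq h.symm
  · rcases hF with hF | hF
    · exact hasSign_of_mem_generators hF h
    · have h' : cls f⁻¹ ≠ cls (hyperelliptic g) := fun h' => h (by
        rw [← inv_inv (cls f), ← hyperelliptic_inv g]
        exact congrArg (·⁻¹) h')
      exact inv_inv f ▸ (hasSign_of_mem_generators (f := f⁻¹) hF h').inv

/-! ### Lifts -/

theorem IsLift.one {X Y : Type*} [TopologicalSpace X] [TopologicalSpace Y] (q : Y → X) :
    IsLift q (1 : X ≃ₜ X) (1 : Y ≃ₜ Y) := fun _ => rfl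

theorem IsLift.mul {X Y : Type*} [TopologicalSpace X] [TopologicalSpace Y] {q : Y → X}
    {f k : X ≃ₜ X} {f' k' : Y ≃ₜ Y} (hf : IsLift q f f') (hk : IsLift q k k') :
    IsLift q (f * k) (f' * k') := fun y =>
  (hf (k' y)).trans (congrArg f (hk y))

/-! ### Paths in the ladder from a point to its translate -/

/-- The point of the ladder over `(x, y)`, on the side `σ`. -/
theorem mem_ladder {g : ℕ} {σ x y : ℝ} (hσ : σ ^ 2 = 1)
    (h : (Circle.exp (2 * Real.pi * x), y) ∈ Plan g) :
    (x, y, σ * √(edge g (Circle.exp (2 * Real.pi * x)) y)) ∈ Ladder g :=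
  ⟨h, by rw [mul_pow, hσ, one_mul]; exact Real.sq_sqrt (edge_nonneg h)⟩

/-- A curve in the planar domain gives a curve on each side of the ladder. -/
theorem joined_of_curve {g : ℕ} {σ : ℝ} (hσ : σ ^ 2 = 1) {x y : unitInterval → ℝ}
    (hx : Continuous x) (hy : Continuous y)
    (h : ∀ t, (Circle.exp (2 * Real.pi * x t), y t) ∈ Plan g) {p q : Ladder g}
    (hp : p.1 = (x 0, y 0, σ * √(edge g (Circle.exp (2 * Real.pi * x 0)) (y 0))))
    (hq : q.1 = (x 1, y 1, σ * √(edge g (Circle.exp (2 * Real.pi * x 1)) (y 1)))) :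
    Joined p q := by
  have h1 : Continuous fun t => Circle.exp (2 * Real.pi * x t) := by fun_prop
  have h3 := (continuous_edge g).comp (h1.prodMk hy)
  exact ⟨⟨⟨fun t => ⟨_, mem_ladder hσ (h t)⟩,
    (hx.prodMk (hy.prodMk (continuous_const.mul h3.sqrt))).subtype_mk _⟩,
    Subtype.ext hp.symm, Subtype.ext hq.symm⟩⟩

theorem hole_exp (j : ℕ) (θ y : ℝ) : hole j (Circle.exp θ) y =
    (1 - Real.cos θ) + (2 * (y - j)) ^ 2 - (1 / ((j : ℝ) + 2)) ^ 2 := by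
  rw [hole, Circle.coe_exp, Complex.exp_ofReal_mul_I_re]

/-- All holes are centred over `u = 1`, so moving away from there at constant height only increases
each `hole j`. -/
theorem mem_plan_of_cos_le {g : ℕ} {θ η y : ℝ} (h : (Circle.exp θ, y) ∈ Plan g)
    (hc : Real.cos η ≤ Real.cos θ) : (Circle.exp η, y) ∈ Plan g := by
  refine ⟨h.1, h.2.1, fun j hj => ?_⟩
  have := h.2.2 j hj
  simp only [hole_exp] at this ⊢
  linarith

/-- Over `u = -1` the term `1 - Re u = 2` exceeds every squared radius, so the vertical segment
there meets no hole. -/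
theorem mem_plan_of_cos_eq_neg_one {g : ℕ} {θ y : ℝ} (h : Real.cos θ = -1) (h0 : 0 ≤ y)
    (hy : y ≤ g) : (Circle.exp θ, y) ∈ Plan g := by
  refine ⟨h0, hy, fun j _ => ?_⟩
  have := rad_le_half j
  have := rad_pos j
  rw [hole_exp, h]
  nlinarith [sq_nonneg (2 * (y - j))]

theorem mem_plan_zero (g : ℕ) (u : Circle) : (u, 0) ∈ Plan g :=
  ⟨le_rfl, Nat.cast_nonneg g, fun j hj => (hole_pos_of_far (by
    have : (1 : ℝ) ≤ j := by exact_mod_cast (Finset.mem_Ico.1 hj).1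
    nlinarith)).le⟩

/-- Every point of the ladder is joined to a point of the boundary line `y = 0`. -/
theorem exists_joined_bottom {g : ℕ} (p : Ladder g) :
    ∃ q : Ladder g, Joined p q ∧ q.1.2 = (0, 0) := by
  obtain ⟨⟨x, y, z⟩, hP, hz⟩ := p
  change (Circle.exp (2 * Real.pi * x), y) ∈ Plan g at hP
  change z ^ 2 = edge g (Circle.exp (2 * Real.pi * x)) y at hz
  obtain ⟨σ, hσ, hzσ⟩ : ∃ σ : ℝ, σ ^ 2 = 1 ∧
      σ * √(edge g (Circle.exp (2 * Real.pi * x)) y) = z := by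
    rw [← hz, Real.sqrt_sq_eq_abs]
    rcases le_total 0 z with h | h
    · exact ⟨1, by norm_num, by rw [abs_of_nonneg h, one_mul]⟩
    · exact ⟨-1, by norm_num, by rw [abs_of_nonpos h]; ring⟩
  -- Here `m` is an integer nearest to `x`, `d` the distance to it and `s` the direction. The path
  -- first increases `d` to `1/2`, away from the column of holes over `m`, and then descends over a
  -- half-integer to `y = 0`.
  obtain ⟨m, d, s, hs, hd0, hd1, hx⟩ : ∃ (m : ℤ) (d s : ℝ), (s = 1 ∨ s = -1) ∧ 0 ≤ d ∧
      d ≤ 1 / 2 ∧ x = m + s * d := by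
    have h := abs_sub_round x
    rcases le_total 0 (x - round x) with h0 | h0
    · exact ⟨round x, x - round x, 1, Or.inl rfl, h0, by rwa [abs_of_nonneg h0] at h, by ring⟩
    · exact ⟨round x, -(x - round x), -1, Or.inr rfl, by linarith,
        by rwa [abs_of_nonpos h0] at h, by ring⟩
  have hcos : ∀ r : ℝ, Real.cos (2 * Real.pi * (m + s * r)) = Real.cos (2 * Real.pi * r) := by
    intro r
    rw [show 2 * Real.pi * (m + s * r) = s * (2 * Real.pi * r) + m * (2 * Real.pi) by ring,
      Real.cos_add_int_mul_two_pi]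
    rcases hs with rfl | rfl
    · rw [one_mul]
    · rw [neg_one_mul, Real.cos_neg]
  have hhalf : Real.cos (2 * Real.pi * (m + s * (1 / 2))) = -1 := by
    rw [hcos, show 2 * Real.pi * (1 / 2) = Real.pi by ring, Real.cos_pi]
  have key1 : ∀ t : unitInterval, (Circle.exp (2 * Real.pi *
      (m + s * ((1 - t) * d + t * (1 / 2)))), y) ∈ Plan g := fun t => by
    have ht0 := t.2.1
    have ht1 := t.2.2
    have hpi := Real.pi_pos
    refine mem_plan_of_cos_le hP ?_
    rw [hcos, hx, hcos]
    -- The distance grows from `d` within `[0, 1/2]`, so `2π` times it stays in `[0, π]`, where the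
    -- cosine decreases.
    apply Real.cos_le_cos_of_nonneg_of_le_pi
    · positivity
    · nlinarith [mul_nonneg (sub_nonneg.2 ht1) (sub_nonneg.2 hd1)]
    · have : d ≤ (1 - t) * d + t * (1 / 2) := by
        nlinarith [mul_nonneg ht0 (sub_nonneg.2 hd1)]
      exact mul_le_mul_of_nonneg_left this (by positivity)
  have key2 : ∀ t : unitInterval, (Circle.exp (2 * Real.pi *
      (m + s * (1 / 2))), (1 - t) * y) ∈ Plan g := fun t => by
    have ht0 := t.2.1
    have ht1 := t.2.2
    have h0 := hP.1
    have h1 := hP.2.1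
    simp only at h0 h1
    exact mem_plan_of_cos_eq_neg_one hhalf (mul_nonneg (by linarith) h0) (by nlinarith)
  have hmid := key1 1
  simp only [Set.Icc.coe_one, sub_self, zero_mul, zero_add, one_mul] at hmid
  refine ⟨⟨(m + s * (1 / 2), 0, 0), mem_plan_zero _ _, by simp [edge]⟩,
    Joined.trans (y := ⟨_, mem_ladder hσ hmid⟩) ?_ ?_, rfl⟩
  · refine joined_of_curve hσ (by fun_prop) continuous_const key1 ?_ ?_
    · simp only [Set.Icc.coe_zero, sub_zero, zero_mul, add_zero, one_mul, ← hx, hzσ]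
    · simp only [Set.Icc.coe_one, sub_self, zero_mul, zero_add, one_mul]
  · refine joined_of_curve hσ continuous_const (by fun_prop) key2 ?_ ?_
    · simp only [Set.Icc.coe_zero, sub_zero, one_mul]
    · simp [edge]

/-- The path goes down to the line `y = 0`, runs along it by one unit, and returns along the
translate of the first piece. On that line `edge` vanishes, so the choice of side `σ` is immaterial.
-/
theorem joined_handleShift {g : ℕ} (p : Ladder g) : Joined p (handleShift g p) := by
  obtain ⟨⟨⟨x, yz⟩, hq⟩, hpq, rfl⟩ := exists_joined_bottom p
  refine (hpq.trans ?_).trans (hpq.symm.map (handleShift g).continuous)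
  refine joined_of_curve (σ := 1) (by norm_num) (x := fun t => x + t) (y := fun _ => 0)
    (by fun_prop) continuous_const (fun t => mem_plan_zero g _) ?_ ?_
  · simp [edge]
  · simp [edge, handleShift]

/-! ### Lifts and the handle shift -/

/-- A lift of a homeomorphism of sign `ε` conjugates the handle shift to its power `ε`. -/
theorem HasSign.lift_mul_handleShift {g : ℕ} {f : Surf g ≃ₜ Surf g} {f' : Ladder g ≃ₜ Ladder g}
    {ε : ℤˣ} (hf : HasSign f ε) (hl : IsLift (cover g) f f') (p : Ladder g) :
    (f' (handleShift g p)).1 = ((f' p).1.1 + (ε : ℤ), (f' p).1.2) := by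
  obtain ⟨φ, hφ, hf⟩ := hf
  have hcov : cover g (handleShift g p) = cover g p := Subtype.ext (by
    change (Circle.exp (2 * Real.pi * (p.1.1 + 1)), _) = _
    rw [exp_shift]; rfl)
  have hc : Continuous (cover g) := by unfold cover; fun_prop
  obtain ⟨γ⟩ := joined_handleShift p
  -- The discrepancy at `p` between two logarithms of the angle of `f (cover g p)`; `exp c = 1`, so
  -- adding `c` aligns the starting points without changing the exponential.
  set c : ℝ := 2 * Real.pi * (f' p).1.1 - ((ε : ℤ) * (2 * Real.pi * p.1.1) + φ (cover g p))
    with hcdef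
  have hexp : ∀ q, Circle.exp (2 * Real.pi * (f' q).1.1) =
      Circle.exp ((ε : ℤ) * (2 * Real.pi * q.1.1) + φ (cover g q)) := fun q => by
    rw [Circle.exp_add, exp_zsmul]
    exact (congrArg (fun r : Surf g => r.1.1) (hl q)).trans (hf _)
  have hc1 : Circle.exp c = 1 := by rw [hcdef, Circle.exp_sub, hexp, div_self']
  -- Both functions of `t` lift the same path in the circle and agree at `t = 0`, hence they agree
  -- at `t = 1`. There `φ` has the same value as at the start because `cover` does not see the
  -- handle shift.
  have h := Circle.isCoveringMap_exp.eq_of_comp_eq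
    (g₁ := fun t => 2 * Real.pi * (f' (γ t)).1.1)
    (g₂ := fun t => (ε : ℤ) * (2 * Real.pi * (γ t).1.1) + φ (cover g (γ t)) + c)
    (by fun_prop) (by fun_prop)
    (funext fun t => by
      simp only [Function.comp_apply]
      rw [Circle.exp_add _ c, hc1, mul_one, hexp]) 0 (by
      simp only [γ.source]
      rw [hcdef]; ring)
  have h1 := congrFun h 1
  simp only [γ.target, hcov] at h1
  have h2 : (f' (handleShift g p)).1.2 = (f' p).1.2 :=
    congrArg (fun r : Surf g => r.1.2) ((hl _).trans ((congrArg f hcov).trans (hl p).symm))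
  refine Prod.ext ?_ h2
  have h3 : (handleShift g p).1.1 = p.1.1 + 1 := rfl
  rw [h3, hcdef] at h1
  have h4 : 2 * Real.pi * ((f' (handleShift g p)).1.1 - ((f' p).1.1 + (ε : ℤ))) = 0 := by
    linarith
  rcases mul_eq_zero.1 h4 with h5 | h5
  · exact absurd h5 (by positivity)
  · exact sub_eq_zero.1 h5

theorem HasSign.commute {g : ℕ} {f : Surf g ≃ₜ Surf g} {f' : Ladder g ≃ₜ Ladder g}
    (hf : HasSign f 1) (hl : IsLift (cover g) f f') :
    handleShift g * f' = f' * handleShift g := by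
  refine Homeomorph.ext fun p => Subtype.ext ?_
  refine Eq.trans ?_ (hf.lift_mul_handleShift hl p).symm
  simp [handleShift]

theorem HasSign.anticommute {g : ℕ} {f : Surf g ≃ₜ Surf g} {f' : Ladder g ≃ₜ Ladder g}
    (hf : HasSign f (-1)) (hl : IsLift (cover g) f f') :
    handleShift g * f' = f' * (handleShift g)⁻¹ := by
  rw [eq_mul_inv_iff_mul_eq]
  refine Homeomorph.ext fun p => Subtype.ext ?_
  have h := hf.lift_mul_handleShift hl p
  change ((f' (handleShift g p)).1.1 + 1, (f' (handleShift g p)).1.2) = _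
  rw [h]
  simp

/-- This makes the two relations mutually exclusive, which turns the implications given by the sign
into equivalences. -/
theorem handleShift_ne_inv (g : ℕ) : handleShift g ≠ (handleShift g)⁻¹ := by
  intro h
  have h1 := congrArg (fun k : Ladder g ≃ₜ Ladder g =>
    (k ⟨(0, 0, 0), mem_plan_zero _ _, by simp [edge]⟩).1.1) h
  change (0 : ℝ) + 1 = 0 - 1 at h1
  norm_num at h1

/-! ### Products of generators and the parity of the number of involutions -/

theorem isLift_prod {X Y : Type*} [TopologicalSpace X] [TopologicalSpace Y] {q : Y → X} :
    ∀ {n : ℕ} {f : Fin n → X ≃ₜ X} {f' : Fin n → Y ≃ₜ Y}, (∀ j, IsLift q (f j) (f' j)) →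
      IsLift q (List.ofFn f).prod (List.ofFn f').prod
  | 0, _, _, _ => by simpa using IsLift.one q
  | n + 1, f, f', h => by
    simp only [List.ofFn_succ, List.prod_cons]
    exact (h 0).mul (isLift_prod fun j => h j.succ)

theorem hasSign_prod {g : ℕ} : ∀ {n : ℕ} {f : Fin n → Surf g ≃ₜ Surf g} {ε : Fin n → ℤˣ},
    (∀ j, HasSign (f j) (ε j)) → HasSign (List.ofFn f).prod (∏ j, ε j)
  | 0, _, _, _ => by simpa using HasSign.one g
  | n + 1, f, ε, h => by
    simp only [List.ofFn_succ, List.prod_cons, Fin.prod_univ_succ]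
    exact (h 0).mul (hasSign_prod fun j => h j.succ)

theorem prod_ite_neg_one {n : ℕ} (P : Fin n → Prop) [DecidablePred P] :
    ∏ j, (if P j then (-1 : ℤˣ) else 1) = (-1) ^ {j | P j}.ncard := by
  rw [Finset.prod_ite, Finset.prod_const, Finset.prod_const_one, mul_one,
    Set.ncard_eq_toFinset_card']
  congr 2
  ext; simp

/-- The hypothesis says that moving `h` past `k` inverts it; moving it past `k` twice restores it.
The second claim and the last assertion of the first both rest on this. -/
theorem sq_of_mul_mul_self {G : Type*} [Group G] {h k : G} (H : h * k * h = k) :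
    h * k ^ 2 * h⁻¹ = k ^ 2 := by
  have h1 : k * h⁻¹ = h * k := by rw [mul_inv_eq_iff_eq_mul, H]
  have h2 : h * k * k * h⁻¹ = h * k * (h * k) := by rw [mul_assoc _ k, h1]
  calc h * k ^ 2 * h⁻¹ = h * k * k * h⁻¹ := by rw [sq, mul_assoc h k k]
    _ = h * k * h * k := by rw [h2, ← mul_assoc]
    _ = k ^ 2 := by rw [H, sq]

end LadderCover

end

theorem mainTheorem7 (g : ℕ) (hg : 3 ≤ g) :
    (∀ (n : ℕ) (F : Fin n → LadderCover.MCG (LadderCover.Surf g))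
      (f : Fin n → LadderCover.Surf g ≃ₜ LadderCover.Surf g)
      (f' : Fin n → LadderCover.Ladder g ≃ₜ LadderCover.Ladder g),
      (∀ j, F j ∈ LadderCover.generators g ∨ (F j)⁻¹ ∈ LadderCover.generators g) →
      (∀ j, LadderCover.cls (f j) = F j) →
      (∀ j, LadderCover.IsLift (LadderCover.cover g) (f j) (f' j)) →
      LadderCover.IsLift (LadderCover.cover g) (List.ofFn f).prod (List.ofFn f').prod ∧
      (LadderCover.handleShift g * (List.ofFn f').prod =
          (List.ofFn f').prod * LadderCover.handleShift g ↔
        Even {j | F j = LadderCover.cls (LadderCover.hyperelliptic g)}.ncard) ∧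
      (LadderCover.handleShift g * (List.ofFn f').prod =
          (List.ofFn f').prod * (LadderCover.handleShift g)⁻¹ ↔
        Odd {j | F j = LadderCover.cls (LadderCover.hyperelliptic g)}.ncard) ∧
      (Odd {j | F j = LadderCover.cls (LadderCover.hyperelliptic g)}.ncard →
        LadderCover.handleShift g * (List.ofFn f').prod ^ 2 =
          (List.ofFn f').prod ^ 2 * LadderCover.handleShift g)) ∧
    (∀ (f : LadderCover.Surf g ≃ₜ LadderCover.Surf g)
      (f' : LadderCover.Ladder g ≃ₜ LadderCover.Ladder g),
      LadderCover.IsLift (LadderCover.cover g) f f' →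
      LadderCover.handleShift g * f' * LadderCover.handleShift g = f' →
      LadderCover.IsLift (LadderCover.cover g) (f ^ 2) (f' ^ 2) ∧
      LadderCover.handleShift g * f' ^ 2 * (LadderCover.handleShift g)⁻¹ = f' ^ 2) := by
  refine ⟨fun n F f f' hF hf hl => ?_, fun f f' hl H =>
    ⟨by simpa only [sq] using hl.mul hl, LadderCover.sq_of_mul_mul_self H⟩⟩
  have hlift := LadderCover.isLift_prod hl
  have hsign := LadderCover.hasSign_prod fun j =>
    LadderCover.hasSign_of_mem_or_inv_mem (hF j) (hf j)
  rw [LadderCover.prod_ite_neg_one] at hsign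
  have hne := LadderCover.handleShift_ne_inv g
  set k := {j | F j = LadderCover.cls (LadderCover.hyperelliptic g)}.ncard
  refine ⟨hlift, ?_⟩
  -- The parity fixes the sign and hence which relation holds; if the other held too, cancelling the
  -- lift would give `h = h⁻¹`.
  rcases Nat.even_or_odd k with hk | hk
  · rw [hk.neg_one_pow] at hsign
    have hc := hsign.commute hlift
    refine ⟨iff_of_true hc hk, iff_of_false (fun h => ?_) (Nat.not_odd_iff_even.2 hk),
      fun h => absurd hk (Nat.not_even_iff_odd.2 h)⟩
    exact hne (mul_left_cancel (hc.symm.trans h))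
  · rw [hk.neg_one_pow] at hsign
    have hc := hsign.anticommute hlift
    refine ⟨iff_of_false (fun h => ?_) (Nat.not_even_iff_odd.2 hk), iff_of_true hc hk, fun _ => ?_⟩
    · exact hne (mul_left_cancel (h.symm.trans hc))
    -- The relation `h * f' = f' * h⁻¹` is `h * f' * h = f'` after multiplying by `h` on the right.
    · exact mul_inv_eq_iff_eq_mul.1
        (LadderCover.sq_of_mul_mul_self (by rw [hc, inv_mul_cancel_right]))
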